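/- Let $g:\mathbb{R}^n\times\mathbb{R}^m\to\mathbb{R}$ and $G=(g_1,\dots,g_s):\mathbb{R}^n\times\mathbb{R}^m\to\mathbb{R}^s$ be $C^2$, with $g(x,\cdot)$ and each $g_i(x,\cdot)$ convex for every $x\in\mathbb{R}^n$, and let $h:\mathbb{R}^s\to[-\infty,\infty]$ be proper, nondecreasing (for the componentwise order) and epi-polyhedral (its epigraph is a polyhedral set), with conjugate $h^*(p)=\sup_z\{\langle z,p\rangle-h(z)\}$. For $\alpha,\beta>0$ put $$\psi_x(y,p)=\begin{pmatrix}-\nabla_y g(x,y)-\nabla_y G(x,y)^\top p-\beta y\\ -G(x,y)+\alpha p\end{pmatrix},\qquad \tilde h(y,p)=h^*(p),$$ $$S_{\alpha,\beta}(x)=\{(y,p)\in\mathbb{R}^m\times\mathbb{R}^s\mid 0\in\psi_x(y,p)+\partial\tilde h(y,p)\},$$ $$L_{\alpha,\beta}(x,y,p)=g(x,y)+\tfrac{\beta}{2}|y|^2+\langle G(x,y),p\rangle-h^*(p)-\tfrac{\alpha}{2}|p|^2 .$$ For $u\in\partial h^*(p)$ let $K_{h^*}(p,u)=N_{\partial h^*(p)}(u)$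 be the critical cone, i.e. the normal cone to $\partial h^*(p)$ at $u$. Suppose that $(\bar y,\bar p)\in S_{\alpha,\beta}(\bar x)$ and that $G(\bar x,\bar y)-\alpha\bar p\in\operatorname{ri}\big(\partial h^*(\bar p)\big)$. Then $S_{\alpha,\beta}$ is single-valued and $C^1$ in a neighborhood of $\bar x$. Moreover, $\mathbb{R}^m\times K_{h^*}(\bar p,G(\bar x,\bar y)-\alpha\bar p)$ is a linear subspace of $\mathbb{R}^m\times\mathbb{R}^s$, and for every matrix $B$ whose columns form a basis of this subspace, $B^\top AB$ is invertible and $$\nabla S_{\alpha,\beta}(\bar x)=-B(B^\top AB)^{-1}B^\top\begin{pmatrix}\nabla_x\nabla_y L_{\alpha,\beta}(\bar x,\bar y,\bar p)\\ \nabla_x G(\bar x,\bar y)\end{pmatrix},\qquad A=\begin{pmatrix}\nabla^2_{yy}L_{\alpha,\beta}(\bar x,\bar y,\bar p)&\nabla_yG(\bar x,\bar y)^\top\\ \nabla_yG(\bar x,\bar y)&-\alpha\mathbb{I}_s\end{pmatrix}.$$ -/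

import Mathlib

open Set Filter Topology

namespace Bilevel

/-! ### Convex and variational analysis in Euclidean spaces -/

section VariationalAnalysis

variable {F : Type*} [NormedAddCommGroup F] [InnerProductSpace ℝ F]

/-- The polar cone `{x' | ⟨x, x'⟩ ≤ 0 for all x ∈ C}`. -/
def polarCone (C : Set F) : Set F := {x' | ∀ x ∈ C, inner ℝ x x' ≤ 0}

/-- The (Bouligand) tangent cone to `C` at `x`: limits of `(x^ν - x) / τ^ν` with `x^ν ∈ C`,
`τ^ν > 0` and `τ^ν → 0`. -/
def tangentCone (C : Set F) (x : F) : Set F :=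
  {w | ∃ (xs : ℕ → F) (τ : ℕ → ℝ), (∀ ν, xs ν ∈ C) ∧ (∀ ν, 0 < τ ν) ∧
    Tendsto τ atTop (𝓝 0) ∧ Tendsto (fun ν => (τ ν)⁻¹ • (xs ν - x)) atTop (𝓝 w)}

/-- The regular normal cone, i.e. the polar of the tangent cone. -/
def regularNormalCone (C : Set F) (x : F) : Set F := polarCone (tangentCone C x)

/-- The (limiting) normal cone: limits of regular normals `u^ν` at points `x^ν ∈ C` tending
to `x`. -/
def normalCone (C : Set F) (x : F) : Set F :=
  {u | ∃ (xs us : ℕ → F), (∀ ν, xs ν ∈ C) ∧ (∀ ν, us ν ∈ regularNormalCone C (xs ν)) ∧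
    Tendsto xs atTop (𝓝 x) ∧ Tendsto us atTop (𝓝 u)}

/-- The epigraph, as a subset of `F × ℝ` with the Euclidean product structure. -/
def epigraph (f : F → EReal) : Set (WithLp 2 (F × ℝ)) := {q | f q.fst ≤ (q.snd : EReal)}

/-- The subdifferential: `u` is a subgradient of `f` at `x` if `f x` is finite and `(u, -1)` is
normal to the epigraph at `(x, f x)`. -/
def subdifferential (f : F → EReal) (x : F) : Set F :=
  {u | ∃ r : ℝ, f x = (r : EReal) ∧
    WithLp.toLp 2 (u, (-1 : ℝ)) ∈ normalCone (epigraph f) (WithLp.toLp 2 (x, r))}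

/-- The critical cone of `f` at `x` for `u ∈ ∂f(x)`. -/
def criticalCone (f : F → EReal) (x u : F) : Set F := normalCone (subdifferential f x) u

/-- The convex conjugate `f*(p) = sup_z {⟨z, p⟩ - f(z)}`. -/
noncomputable def conjugate (f : F → EReal) (p : F) : EReal :=
  ⨆ z : F, ((inner ℝ z p : ℝ) : EReal) - f z

/-- A proper extended real-valued function. -/
def IsProper (f : F → EReal) : Prop := (∃ z, f z < ⊤) ∧ ∀ z, f z ≠ ⊥

/-- A polyhedral set: an intersection of finitely many closed half-spaces. -/
def IsPolyhedral (C : Set F) : Prop :=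
  ∃ (k : ℕ) (a : Fin k → F) (b : Fin k → ℝ), C = {x | ∀ i, inner ℝ (a i) x ≤ b i}

/-- A function whose epigraph is polyhedral. -/
def IsEpiPolyhedral (f : F → EReal) : Prop := IsPolyhedral (epigraph f)

end VariationalAnalysis

/-- Real vectors indexed by `ι`, with the Euclidean norm. -/
abbrev Vec (ι : Type*) := EuclideanSpace ℝ ι

/-- `f` is nondecreasing for the componentwise order. -/
def IsNondecreasing {ι : Type*} (f : Vec ι → EReal) : Prop :=
  ∀ z z' : Vec ι, (∀ i, z i ≤ z' i) → f z ≤ f z'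

/-- The Jacobian matrix of `Φ` at `x`; rows are indexed by the components of `Φ`. -/
noncomputable def jacobian {ι κ : Type*} [Fintype ι] [DecidableEq ι] [Fintype κ]
    (Φ : Vec ι → Vec κ) (x : Vec ι) : Matrix κ ι ℝ :=
  Matrix.of fun k i => fderiv ℝ Φ x (EuclideanSpace.single i 1) k

/-! ### Primal-dual pairs `(y, p)` as elements of `ℝ^{m+s}` -/

/-- The vector `(y, p)`. -/
def pair {m s : ℕ} (y : Vec (Fin m)) (p : Vec (Fin s)) : Vec (Fin m ⊕ Fin s) :=
  WithLp.toLp 2 (Sum.elim y p)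

/-- The component `y` of `(y, p)`. -/
def primalPart {m s : ℕ} (v : Vec (Fin m ⊕ Fin s)) : Vec (Fin m) :=
  WithLp.toLp 2 fun i => v (Sum.inl i)

/-- The component `p` of `(y, p)`. -/
def dualPart {m s : ℕ} (v : Vec (Fin m ⊕ Fin s)) : Vec (Fin s) :=
  WithLp.toLp 2 fun i => v (Sum.inr i)

/-! ### The regularized lower-level problem -/

section LowerLevel

variable {n m s : ℕ}

/-- The gradient `∇_y g(x, y)`. -/
noncomputable def gradY (g : Vec (Fin n) × Vec (Fin m) → ℝ) (x : Vec (Fin n))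
    (y : Vec (Fin m)) : Vec (Fin m) :=
  gradient (fun y' => g (x, y')) y

/-- The partial Jacobian `∇_y G(x, y)`, an `s × m` matrix. -/
noncomputable def jacY (G : Vec (Fin n) × Vec (Fin m) → Vec (Fin s)) (x : Vec (Fin n))
    (y : Vec (Fin m)) : Matrix (Fin s) (Fin m) ℝ :=
  jacobian (fun y' => G (x, y')) y

/-- The partial Jacobian `∇_x G(x, y)`, an `s × n` matrix. -/
noncomputable def jacX (G : Vec (Fin n) × Vec (Fin m) → Vec (Fin s)) (x : Vec (Fin n))
    (y : Vec (Fin m)) : Matrix (Fin s) (Fin n) ℝ :=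
  jacobian (fun x' => G (x', y)) x

/-- The mapping
`ψ_x(y, p) = (-∇_y g(x, y) - ∇_y G(x, y)ᵀ p - β y, -G(x, y) + α p)`. -/
noncomputable def psi (g : Vec (Fin n) × Vec (Fin m) → ℝ)
    (G : Vec (Fin n) × Vec (Fin m) → Vec (Fin s)) (α β : ℝ) (x : Vec (Fin n))
    (v : Vec (Fin m ⊕ Fin s)) : Vec (Fin m ⊕ Fin s) :=
  let y := primalPart v
  let p := dualPart v
  pair (-gradY g x y - WithLp.toLp 2 ((jacY G x y).transpose.mulVec p) - β • y)
    (-G (x, y) + α • p)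

/-- The function `h̃(y, p) = h*(p)`. -/
noncomputable def hTilde (h : Vec (Fin s) → EReal) (v : Vec (Fin m ⊕ Fin s)) : EReal :=
  conjugate h (dualPart v)

/-- The primal-dual solution mapping `S_{α,β}`: the pairs `(y, p)` with
`0 ∈ ψ_x(y, p) + ∂h̃(y, p)`. -/
def solutionMap (g : Vec (Fin n) × Vec (Fin m) → ℝ)
    (G : Vec (Fin n) × Vec (Fin m) → Vec (Fin s)) (h : Vec (Fin s) → EReal) (α β : ℝ)
    (x : Vec (Fin n)) : Set (Vec (Fin m ⊕ Fin s)) :=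
  {v | ∃ u ∈ subdifferential (hTilde (m := m) h) v, 0 = psi g G α β x v + u}

/-- The Lagrangian
`L_{α,β}(x, y, p) = g(x, y) + (β/2)|y|² + ⟨G(x, y), p⟩ - h*(p) - (α/2)|p|²`. -/
noncomputable def lagrangian (g : Vec (Fin n) × Vec (Fin m) → ℝ)
    (G : Vec (Fin n) × Vec (Fin m) → Vec (Fin s)) (h : Vec (Fin s) → EReal) (α β : ℝ)
    (x : Vec (Fin n)) (y : Vec (Fin m)) (p : Vec (Fin s)) : EReal :=
  ((g (x, y) + β / 2 * ‖y‖ ^ 2 + inner ℝ (G (x, y)) p : ℝ) : EReal) - conjugate h p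
    - ((α / 2 * ‖p‖ ^ 2 : ℝ) : EReal)

/-- The gradient `∇_y L_{α,β}(x, y, p)`, for `p` with `h*(p)` finite (the Lagrangian is then real
for all `x` and `y`). -/
noncomputable def gradYLagrangian (g : Vec (Fin n) × Vec (Fin m) → ℝ)
    (G : Vec (Fin n) × Vec (Fin m) → Vec (Fin s)) (h : Vec (Fin s) → EReal) (α β : ℝ)
    (x : Vec (Fin n)) (y : Vec (Fin m)) (p : Vec (Fin s)) : Vec (Fin m) :=
  gradient (fun y' => (lagrangian g G h α β x y' p).toReal) y

/-- The Hessian `∇²_{yy} L_{α,β}(x, y, p)`. -/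
noncomputable def hessYYLagrangian (g : Vec (Fin n) × Vec (Fin m) → ℝ)
    (G : Vec (Fin n) × Vec (Fin m) → Vec (Fin s)) (h : Vec (Fin s) → EReal) (α β : ℝ)
    (x : Vec (Fin n)) (y : Vec (Fin m)) (p : Vec (Fin s)) : Matrix (Fin m) (Fin m) ℝ :=
  jacobian (fun y' => gradYLagrangian g G h α β x y' p) y

/-- The mixed derivative `∇_x ∇_y L_{α,β}(x, y, p)`, an `m × n` matrix. -/
noncomputable def gradXGradYLagrangian (g : Vec (Fin n) × Vec (Fin m) → ℝ)
    (G : Vec (Fin n) × Vec (Fin m) → Vec (Fin s)) (h : Vec (Fin s) → EReal) (α β : ℝ)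
    (x : Vec (Fin n)) (y : Vec (Fin m)) (p : Vec (Fin s)) : Matrix (Fin m) (Fin n) ℝ :=
  jacobian (fun x' => gradYLagrangian g G h α β x' y p) x

/-- The matrix `A = (∇²_{yy} L_{α,β}, ∇_y Gᵀ; ∇_y G, -α I)` at `(x, y, p)`. -/
noncomputable def kktMatrix (g : Vec (Fin n) × Vec (Fin m) → ℝ)
    (G : Vec (Fin n) × Vec (Fin m) → Vec (Fin s)) (h : Vec (Fin s) → EReal) (α β : ℝ)
    (x : Vec (Fin n)) (y : Vec (Fin m)) (p : Vec (Fin s)) :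
    Matrix (Fin m ⊕ Fin s) (Fin m ⊕ Fin s) ℝ :=
  Matrix.fromBlocks (hessYYLagrangian g G h α β x y p) (jacY G x y).transpose
    (jacY G x y) (-(α • (1 : Matrix (Fin s) (Fin s) ℝ)))

/-- The matrix `(∇_x ∇_y L_{α,β}; ∇_x G)` at `(x, y, p)`. -/
noncomputable def paramMatrix (g : Vec (Fin n) × Vec (Fin m) → ℝ)
    (G : Vec (Fin n) × Vec (Fin m) → Vec (Fin s)) (h : Vec (Fin s) → EReal) (α β : ℝ)
    (x : Vec (Fin n)) (y : Vec (Fin m)) (p : Vec (Fin s)) : Matrix (Fin m ⊕ Fin s) (Fin n) ℝ :=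
  Matrix.of (Sum.elim (gradXGradYLagrangian g G h α β x y p) (jacX G x y))

/-- The set `ℝ^m × K_{h*}(p, u)` in `ℝ^{m+s}`. -/
def criticalProduct (m : ℕ) (h : Vec (Fin s) → EReal) (p u : Vec (Fin s)) :
    Set (Vec (Fin m ⊕ Fin s)) :=
  {v | dualPart v ∈ criticalCone (conjugate h) p u}

/-- The columns of `B` form a basis of the linear subspace `W`. -/
def ColumnsFormBasis {ι : Type*} {k : ℕ} (B : Matrix ι (Fin k) ℝ)
    (W : Submodule ℝ (Vec ι)) : Prop :=
  LinearIndependent ℝ (fun j => (WithLp.toLp 2 (B.col j) : Vec ι)) ∧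
    Submodule.span ℝ (Set.range fun j => (WithLp.toLp 2 (B.col j) : Vec ι)) = W

end LowerLevel

end Bilevel

open Set Filter Topology

namespace Bilevel

/-! ### Normal cones, subdifferentials and conjugates in the convex case -/

section ConvexAnalysis

variable {F : Type*} [NormedAddCommGroup F] [InnerProductSpace ℝ F]

/-! Write `Ψ = -ψ`, `v̄ = (ȳ, p̄)`, `ū = G(x̄, ȳ) - αp̄`, and let `L` be the direction of the affine
hull of `∂h*(p̄)`. Since `ū` is in the relative interior of this closed convex set, the critical
cone is `Lᗮ`, a subspace. Put `W = ℝ^m × Lᗮ`, so that `Wᗮ = {0} × L`.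

The crux is that polyhedrality makes the graph of `∂h*` locally flat: it contains every pair near
`(p̄, ū)` in `(p̄ + Lᗮ) × (ū + L)` (`exists_forall_mem_subdifferential_conjugate`). This is weak
sharpness of the minimizers of a polyhedral function, and comes from Farkas' lemma. Hence, near
`(x̄, v̄)`, any solution of the smooth system `v - v̄ ∈ W`, `Ψ(x, v) - Ψ(x̄, v̄) ∈ Wᗮ` solves the
generalized equation. Only this inclusion is needed: solutions are unique by strong monotonicity
(`subsingleton_solutionMap`), where convexity, `p ≥ 0` and `α, β > 0` enter.

The system is solved by the implicit function theorem (`exists_implicit_of_projected_injective`).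
Its linearization in `v` is the compression of `A` to `W`, which is injective by the saddle
structure of `A`. Differentiating gives `S'ξ ∈ W` and `Qξ + A S'ξ ∈ Wᗮ`, with `Q` the parameter
matrix; in a basis `B` of `W` this is the stated formula. -/

theorem sub_mem_tangentCone {C : Set F} (hC : Convex ℝ C) {x x' : F} (hx : x ∈ C)
    (hx' : x' ∈ C) : x' - x ∈ tangentCone C x := by
  refine ⟨fun ν => x + (1 / ((ν : ℝ) + 1)) • (x' - x), fun ν => 1 / ((ν : ℝ) + 1), fun ν => ?_,
    fun ν => by positivity, tendsto_one_div_add_atTop_nhds_zero_nat, ?_⟩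
  · refine hC.add_smul_sub_mem hx hx' ⟨by positivity, ?_⟩
    rw [div_le_one (by positivity)]
    linarith [(Nat.cast_nonneg ν : (0 : ℝ) ≤ ν)]
  · refine tendsto_const_nhds.congr fun ν => ?_
    have : (1 / ((ν : ℝ) + 1)) ≠ 0 := by positivity
    rw [add_sub_cancel_left, smul_smul, inv_mul_cancel₀ this, one_smul]

/-- For closed convex sets the limiting normal cone is the normal cone of convex analysis. -/
theorem mem_normalCone_iff_of_convex {C : Set F} (hC : Convex ℝ C) (hcl : IsClosed C) {x u : F} :
    u ∈ normalCone C x ↔ x ∈ C ∧ ∀ x' ∈ C, inner ℝ (x' - x) u ≤ 0 := by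
  constructor
  · rintro ⟨xs, us, hxs, hus, hx, hu⟩
    refine ⟨hcl.mem_of_tendsto hx (Eventually.of_forall hxs), fun x' hx' => ?_⟩
    refine le_of_tendsto ((tendsto_const_nhds.sub hx).inner hu) (Eventually.of_forall fun ν => ?_)
    exact hus ν _ (sub_mem_tangentCone hC (hxs ν) hx')
  · rintro ⟨hx, hu⟩
    refine ⟨fun _ => x, fun _ => u, fun _ => hx, fun _ => ?_, tendsto_const_nhds,
      tendsto_const_nhds⟩
    rintro w ⟨xs, τ, hxs, hτ, -, hw⟩
    refine le_of_tendsto (hw.inner tendsto_const_nhds) (Eventually.of_forall fun ν => ?_)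
    rw [real_inner_smul_left]
    exact mul_nonpos_of_nonneg_of_nonpos (inv_nonneg.2 (hτ ν).le) (hu _ (hxs ν))

/-- For functions with closed convex epigraph the subdifferential is that of convex analysis. -/
theorem mem_subdifferential_iff_of_convex {f : F → EReal} (hC : Convex ℝ (epigraph f))
    (hcl : IsClosed (epigraph f)) {x u : F} :
    u ∈ subdifferential f x ↔
      ∃ r : ℝ, f x = r ∧ ∀ x' (t : ℝ), f x' ≤ t → r + inner ℝ u (x' - x) ≤ t := by
  refine exists_congr fun r => and_congr_right fun hr => ?_
  rw [mem_normalCone_iff_of_convex hC hcl]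
  have key : ∀ (x' : F) (t : ℝ),
      inner ℝ (WithLp.toLp 2 (x', t) - WithLp.toLp 2 (x, r)) (WithLp.toLp 2 (u, (-1 : ℝ))) =
        inner ℝ u (x' - x) - (t - r) := by
    intro x' t
    rw [WithLp.prod_inner_apply, real_inner_comm]
    simp
    ring
  constructor
  · rintro ⟨-, h⟩ x' t ht
    have := h (WithLp.toLp 2 (x', t)) ht
    rw [key] at this
    linarith
  · intro h
    refine ⟨by simp [epigraph, hr], fun q hq => ?_⟩
    have := h q.fst q.snd hq
    have e := key q.fst q.snd
    change inner ℝ (q - _) _ = _ at e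
    rw [e]
    linarith

/-- Quantifying over epigraph points `(z, t)` rather than over values `f z` keeps all later
inequalities in `ℝ`. -/
theorem conjugate_le_coe_iff {f : F → EReal} {p : F} {r : ℝ} :
    conjugate f p ≤ r ↔ ∀ z (t : ℝ), f z ≤ t → inner ℝ z p - t ≤ r := by
  rw [conjugate, iSup_le_iff]
  refine forall_congr' fun z => ?_
  induction f z using EReal.rec with
  | bot =>
    simp only [EReal.coe_sub_bot, top_le_iff, EReal.coe_ne_top, bot_le, true_imp_iff, false_iff,
      not_forall, not_le]
    -- When `f z = ⊥` every real `t` is admissible; this one violates the bound by 1.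
    exact ⟨inner ℝ z p - r - 1, by linarith⟩
  | top => simp
  | coe a =>
    rw [← EReal.coe_sub, EReal.coe_le_coe_iff]
    refine ⟨fun h t ht => ?_, fun h => h a le_rfl⟩
    have := EReal.coe_le_coe_iff.1 ht
    linarith

/-- An intersection of closed half-spaces, one for each epigraph point of `f`. The map `T` allows
for `h*` (identity) and `h̃` (projection onto `p`) at once. -/
theorem epigraph_conjugate_comp {E : Type*} [NormedAddCommGroup E] [InnerProductSpace ℝ E]
    (f : F → EReal) (T : E →L[ℝ] F) :
    Convex ℝ (epigraph fun v => conjugate f (T v)) ∧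
      IsClosed (epigraph fun v => conjugate f (T v)) := by
  have h : (epigraph fun v => conjugate f (T v)) =
      ⋂ (z : F) (t : ℝ) (_ : f z ≤ t), {q | inner ℝ z (T q.fst) - t ≤ q.snd} := by
    ext q
    simp only [epigraph, mem_ofPred_eq, conjugate_le_coe_iff, mem_iInter]
  rw [h]
  constructor
  · refine convex_iInter fun z => convex_iInter fun t => convex_iInter fun _ => ?_
    intro q hq q' hq' a b ha hb hab
    simp only [mem_ofPred_eq, WithLp.add_fst, WithLp.smul_fst, WithLp.add_snd, WithLp.smul_snd,
      map_add, map_smul, inner_add_right, real_inner_smul_right, smul_eq_mul] at hq hq' ⊢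
    have : t = a * t + b * t := by rw [← add_mul, hab, one_mul]
    nlinarith [mul_le_mul_of_nonneg_left hq ha, mul_le_mul_of_nonneg_left hq' hb]
  · refine isClosed_iInter fun z => isClosed_iInter fun t => isClosed_iInter fun _ => ?_
    refine isClosed_le ?_ ?_
    · fun_prop
    · fun_prop

theorem mem_subdifferential_conjugate_comp {E : Type*} [NormedAddCommGroup E]
    [InnerProductSpace ℝ E] (f : F → EReal) (T : E →L[ℝ] F) {x u : E} :
    u ∈ subdifferential (fun v => conjugate f (T v)) x ↔
      ∃ r : ℝ, conjugate f (T x) = r ∧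
        ∀ x' (t : ℝ), conjugate f (T x') ≤ t → r + inner ℝ u (x' - x) ≤ t :=
  mem_subdifferential_iff_of_convex (epigraph_conjugate_comp f T).1 (epigraph_conjugate_comp f T).2

theorem mem_subdifferential_conjugate {f : F → EReal} {p u : F} :
    u ∈ subdifferential (conjugate f) p ↔
      ∃ r : ℝ, conjugate f p = r ∧
        ∀ p' (t : ℝ), conjugate f p' ≤ t → r + inner ℝ u (p' - p) ≤ t :=
  mem_subdifferential_conjugate_comp f (.id ℝ F)

theorem subdifferential_conjugate_convex (f : F → EReal) (p : F) :
    Convex ℝ (subdifferential (conjugate f) p) := by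
  intro u hu u' hu' a b ha hb hab
  rw [mem_subdifferential_conjugate] at *
  obtain ⟨r, hr, h⟩ := hu
  obtain ⟨r', hr', h'⟩ := hu'
  obtain rfl : r = r' := by rw [hr] at hr'; exact_mod_cast hr'
  refine ⟨r, hr, fun p' t ht => ?_⟩
  have h1 := mul_le_mul_of_nonneg_left (h p' t ht) ha
  have h2 := mul_le_mul_of_nonneg_left (h' p' t ht) hb
  rw [inner_add_left, real_inner_smul_left, real_inner_smul_left]
  obtain rfl : b = 1 - a := by linarith
  linarith

theorem subdifferential_conjugate_isClosed (f : F → EReal) (p : F) :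
    IsClosed (subdifferential (conjugate f) p) := by
  by_cases hp : ∃ r : ℝ, conjugate f p = r
  · obtain ⟨r, hr⟩ := hp
    have : subdifferential (conjugate f) p = ⋂ (p' : F) (t : ℝ) (_ : conjugate f p' ≤ t),
        {u | r + inner ℝ u (p' - p) ≤ t} := by
      ext u
      simp only [mem_subdifferential_conjugate, hr, EReal.coe_eq_coe_iff, mem_iInter, mem_ofPred_eq]
      exact ⟨fun ⟨r', e, h⟩ => e ▸ h, fun h => ⟨r, rfl, h⟩⟩
    rw [this]
    refine isClosed_iInter fun z => isClosed_iInter fun t => isClosed_iInter fun _ => ?_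
    exact isClosed_le (by fun_prop) continuous_const
  · have : subdifferential (conjugate f) p = ∅ := by
      ext u
      simp only [mem_subdifferential_conjugate, mem_empty_iff_false, iff_false]
      exact fun ⟨r, hr, _⟩ => hp ⟨r, hr⟩
    rw [this]
    exact isClosed_empty

/-- The subdifferential of a conjugate is monotone. -/
theorem inner_sub_nonneg_of_mem_subdifferential_conjugate {f : F → EReal} {p p' u u' : F}
    (hu : u ∈ subdifferential (conjugate f) p) (hu' : u' ∈ subdifferential (conjugate f) p') :
    0 ≤ inner ℝ (u - u') (p - p') := by
  obtain ⟨r, hr, h⟩ := mem_subdifferential_conjugate.1 hu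
  obtain ⟨r', hr', h'⟩ := mem_subdifferential_conjugate.1 hu'
  have h1 := h p' r' hr'.le
  have h2 := h' p r hr.le
  rw [← neg_sub p p', inner_neg_right] at h1
  rw [inner_sub_left]
  linarith

/-- An affine minorant of `f` exact at `u` yields a subgradient of the conjugate. -/
theorem mem_subdifferential_conjugate_of_le {f : F → EReal} {p u : F} {r : ℝ} (hu : f u ≤ r)
    (h : ∀ z (t : ℝ), f z ≤ t → r + inner ℝ p (z - u) ≤ t) :
    u ∈ subdifferential (conjugate f) p := by
  rw [mem_subdifferential_conjugate]
  refine ⟨inner ℝ u p - r, le_antisymm (conjugate_le_coe_iff.2 fun z t hz => ?_) ?_,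
    fun p' t ht => ?_⟩
  · have := h z t hz
    rw [inner_sub_right, real_inner_comm z p, real_inner_comm u p] at this
    linarith
  · refine le_trans ?_ (le_iSup _ u)
    rw [EReal.coe_sub]
    exact EReal.sub_le_sub le_rfl hu
  · have := conjugate_le_coe_iff.1 ht u r hu
    rw [inner_sub_right]
    linarith

theorem exists_ball_subset_of_mem_intrinsicInterior {C : Set F} {x : F}
    (hx : x ∈ intrinsicInterior ℝ C) :
    ∃ ε > 0, ∀ x', x' - x ∈ vectorSpan ℝ C → ‖x' - x‖ < ε → x' ∈ C := by
  obtain ⟨y, hy, rfl⟩ := mem_intrinsicInterior.1 hx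
  rw [mem_interior_iff_mem_nhds, Metric.mem_nhds_iff] at hy
  obtain ⟨ε, hε, h⟩ := hy
  refine ⟨ε, hε, fun x' hx' hn => ?_⟩
  have hm : x' ∈ affineSpan ℝ C := by
    rw [← direction_affineSpan] at hx'
    simpa using AffineSubspace.vadd_mem_of_mem_direction hx' y.2
  have : (⟨x', hm⟩ : affineSpan ℝ C) ∈ Metric.ball y ε := by
    rw [Metric.mem_ball, Subtype.dist_eq, dist_eq_norm]
    exact hn
  exact h this

/-- From a relative interior point one may move a little along both `w` and `-w`, so the normal
inequality becomes an equality. -/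
theorem normalCone_of_mem_intrinsicInterior {C : Set F} (hC : Convex ℝ C) (hcl : IsClosed C)
    {x : F} (hx : x ∈ intrinsicInterior ℝ C) :
    normalCone C x = ((vectorSpan ℝ C)ᗮ : Submodule ℝ F) := by
  ext q
  rw [mem_normalCone_iff_of_convex hC hcl, SetLike.mem_coe, Submodule.mem_orthogonal]
  constructor
  · rintro ⟨-, h⟩ w hw
    obtain ⟨ε, hε, hball⟩ := exists_ball_subset_of_mem_intrinsicInterior hx
    obtain ⟨t, ht, htw⟩ : ∃ t : ℝ, 0 < t ∧ t * ‖w‖ < ε := by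
      refine ⟨ε / (‖w‖ + 1), by positivity, ?_⟩
      rw [div_mul_eq_mul_div, div_lt_iff₀ (by positivity)]
      nlinarith [norm_nonneg w]
    have key : ∀ r : ℝ, |r| = t → r * inner ℝ w q ≤ 0 := by
      intro r hr
      have := h (x + r • w) (hball _ ?_ ?_)
      · rwa [add_sub_cancel_left, real_inner_smul_left] at this
      · rw [add_sub_cancel_left]
        exact Submodule.smul_mem _ _ hw
      · rwa [add_sub_cancel_left, norm_smul, Real.norm_eq_abs, hr]
    have h1 := key t (abs_of_pos ht)
    have h2 := key (-t) (by rw [abs_neg, abs_of_pos ht])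
    nlinarith
  · exact fun h => ⟨intrinsicInterior_subset hx, fun c hc =>
      (h _ (vsub_mem_vectorSpan ℝ hc (intrinsicInterior_subset hx))).le⟩

end ConvexAnalysis

/-! ### Farkas' lemma and local structure of conjugates of polyhedral functions -/

section Polyhedral

theorem IsProper.exists_coe {F : Type*} {f : F → EReal} (hf : IsProper f) :
    ∃ z, ∃ t : ℝ, f z = t := by
  obtain ⟨⟨z, hz⟩, hbot⟩ := hf
  exact ⟨z, (f z).toReal, (EReal.coe_toReal hz.ne (hbot z)).symm⟩

/-- **Farkas' lemma** for finitely many linear functionals. -/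
theorem exists_nonneg_sum_eq_of_forall_nonpos {V ι : Type*} [AddCommGroup V] [Module ℝ V]
    (s : Finset ι) (a : ι → V →ₗ[ℝ] ℝ) (b : V →ₗ[ℝ] ℝ)
    (h : ∀ v, (∀ i ∈ s, a i v ≤ 0) → b v ≤ 0) :
    ∃ c : ι → ℝ, (∀ i, 0 ≤ c i) ∧ ∀ v, b v = ∑ i ∈ s, c i * a i v := by
  classical
  induction s using Finset.induction_on generalizing a b with
  | empty =>
    refine ⟨0, fun _ => le_rfl, fun v => ?_⟩
    have h1 := h v (by simp)
    have h2 := h (-v) (by simp)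
    rw [map_neg] at h2
    rw [Finset.sum_empty]
    linarith
  | insert j s hj ih =>
    by_cases hs : ∀ v, (∀ i ∈ s, a i v ≤ 0) → b v ≤ 0
    · obtain ⟨c, hc, e⟩ := ih a b hs
      refine ⟨fun i => if i = j then 0 else c i, fun i => ?_, fun v => ?_⟩
      · dsimp only
        split_ifs
        exacts [le_rfl, hc i]
      · rw [Finset.sum_insert hj]
        beta_reduce
        rw [if_pos rfl, zero_mul, zero_add, e v]
        refine Finset.sum_congr rfl fun i hi => ?_
        rw [if_neg (ne_of_mem_of_not_mem hi hj)]
    · push Not at hs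
      obtain ⟨w, hw, hbw⟩ := hs
      have hjw : 0 < a j w := by
        by_contra hcon
        push Not at hcon
        have := h w (by simpa [hcon] using hw)
        linarith
      -- Eliminate `a j`: projecting `v` along `w` onto the kernel of `a j` turns the other
      -- functionals into these combinations, to which the induction hypothesis applies.
      have hred : ∀ v, (∀ i ∈ s, (a i - (a i w / a j w) • a j) v ≤ 0) →
          (b - (b w / a j w) • a j) v ≤ 0 := by
        intro v hv
        have := h (v - (a j v / a j w) • w) fun i hi => ?_
        · simp only [LinearMap.sub_apply, LinearMap.smul_apply, smul_eq_mul, map_sub,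
            map_smul] at this ⊢
          have e : b w / a j w * a j v = a j v / a j w * b w := by ring
          linarith
        · rw [map_sub, map_smul, smul_eq_mul]
          rcases Finset.mem_insert.1 hi with rfl | hi
          · rw [div_mul_cancel₀ _ hjw.ne', sub_self]
          · have := hv i hi
            simp only [LinearMap.sub_apply, LinearMap.smul_apply, smul_eq_mul] at this
            have e : a i w / a j w * a j v = a j v / a j w * a i w := by ring
            linarith
      obtain ⟨c, hc, e⟩ := ih _ _ hred
      -- The weight of `a j` is forced by evaluating the identity at `w`; it is nonnegative because
      -- `b w > 0` and `a i w ≤ 0` on `s`.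
      refine ⟨fun i => if i = j then (b w - ∑ i ∈ s, c i * a i w) / a j w else c i,
        fun i => ?_, fun v => ?_⟩
      · dsimp only
        split_ifs
        · refine div_nonneg (sub_nonneg.2 (le_trans ?_ hbw.le)) hjw.le
          exact Finset.sum_nonpos fun i hi => mul_nonpos_of_nonneg_of_nonpos (hc i) (hw i hi)
        · exact hc i
      · rw [Finset.sum_insert hj]
        beta_reduce
        rw [if_pos rfl]
        have e1 := e v
        simp only [LinearMap.sub_apply, LinearMap.smul_apply, smul_eq_mul] at e1
        have e2 : ∑ i ∈ s, (if i = j then (b w - ∑ i ∈ s, c i * a i w) / a j w else c i) * a i v =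
            ∑ i ∈ s, c i * a i v :=
          Finset.sum_congr rfl fun i hi => by rw [if_neg (ne_of_mem_of_not_mem hi hj)]
        have e3 : ∑ i ∈ s, c i * (a i v - a i w / a j w * a j v) =
            ∑ i ∈ s, c i * a i v - (∑ i ∈ s, c i * a i w) / a j w * a j v := by
          rw [Finset.sum_div, Finset.sum_mul, ← Finset.sum_sub_distrib]
          exact Finset.sum_congr rfl fun i _ => by ring
        rw [e2]
        rw [e3] at e1
        rw [sub_div]
        linarith

variable {F : Type*} [NormedAddCommGroup F] [InnerProductSpace ℝ F]

theorem IsEpiPolyhedral.exists_halfspaces {f : F → EReal} (hf : IsEpiPolyhedral f) :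
    ∃ (k : ℕ) (a : Fin k → F) (c b : Fin k → ℝ),
      ∀ z (t : ℝ), f z ≤ t ↔ ∀ i, inner ℝ (a i) z + c i * t ≤ b i := by
  obtain ⟨k, a, b, h⟩ := hf
  refine ⟨k, fun i => (a i).fst, fun i => (a i).snd, b, fun z t => ?_⟩
  have := Set.ext_iff.1 h (WithLp.toLp 2 (z, t))
  simp only [epigraph, mem_ofPred_eq, WithLp.prod_inner_apply] at this
  refine this.trans (forall_congr' fun i => ?_)
  simp [mul_comm]

/-- The Fenchel equality for an epi-polyhedral function at a subgradient of its conjugate. -/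
theorem le_of_mem_subdifferential_conjugate {f : F → EReal} (hf : IsEpiPolyhedral f)
    (hp : IsProper f) {p u : F} {r : ℝ} (hr : conjugate f p = r)
    (hu : u ∈ subdifferential (conjugate f) p) : f u ≤ ((inner ℝ u p - r : ℝ) : EReal) := by
  obtain ⟨k, a, c, b, hepi⟩ := hf.exists_halfspaces
  obtain ⟨z₀, t₀, h₀⟩ := hp.exists_coe
  obtain ⟨r', hr', h⟩ := mem_subdifferential_conjugate.1 hu
  obtain rfl : r = r' := by rw [hr] at hr'; exact_mod_cast hr'
  rw [hepi]
  intro i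
  by_contra hcon
  push Not at hcon
  have hi : ∀ z (t : ℝ), f z ≤ t → inner ℝ (a i) z + c i * t ≤ b i :=
    fun z t hz => (hepi z t).1 hz i
  -- The epigraph is closed under increasing `t`, so no constraint can bound `t` from above.
  have hc : c i ≤ 0 := by
    by_contra hc
    push Not at hc
    set T := max t₀ ((b i - inner ℝ (a i) z₀) / c i + 1)
    have h1 := hi z₀ T (h₀.le.trans (EReal.coe_le_coe_iff.2 (le_max_left _ _)))
    have h2 : (b i - inner ℝ (a i) z₀) / c i + 1 ≤ T := le_max_right _ _
    have h3 : b i - inner ℝ (a i) z₀ < c i * T := by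
      rw [← div_lt_iff₀' hc]
      linarith
    linarith
  -- If `c i < 0`, the constraint is an affine minorant of `f` with slope `-a i / c i`, and the
  -- subgradient inequality is tested there. If `c i = 0`, it bounds the domain of `f`, and the test
  -- point is `p + a i`.
  rcases hc.lt_or_eq with hc | hc
  · have h1 : conjugate f ((-(c i)⁻¹) • a i) ≤ ((-(c i)⁻¹ * b i : ℝ) : EReal) := by
      rw [conjugate_le_coe_iff]
      intro z t hz
      have h2 := mul_le_mul_of_nonneg_left (hi z t hz) (neg_nonneg.2 (inv_nonpos.2 hc.le))
      rw [real_inner_smul_right, real_inner_comm]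
      have h3 : -(c i)⁻¹ * (c i * t) = -t := by
        have := hc.ne
        field_simp
      linarith
    have h2 := h _ _ h1
    rw [inner_sub_right, real_inner_smul_right] at h2
    have h3 := mul_lt_mul_of_pos_left hcon (neg_pos.2 (inv_lt_zero.2 hc))
    have h4 : -(c i)⁻¹ * (c i * (inner ℝ u p - r)) = -(inner ℝ u p - r) := by
      have := hc.ne
      field_simp
    rw [mul_add, h4] at h3
    have h5 : inner ℝ (a i) u = inner ℝ u (a i) := real_inner_comm _ _
    rw [h5] at h3
    linarith
  · have h1 : conjugate f (p + a i) ≤ ((r + b i : ℝ) : EReal) := by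
      rw [conjugate_le_coe_iff]
      intro z t hz
      have h2 := hi z t hz
      have h3 := conjugate_le_coe_iff.1 hr.le z t hz
      rw [hc, zero_mul, add_zero, real_inner_comm] at h2
      rw [inner_add_right]
      linarith
    have h2 := h _ _ h1
    rw [add_sub_cancel_left, real_inner_comm] at h2
    rw [hc, zero_mul, add_zero] at hcon
    linarith

/-- Weak sharpness of the minimizers of a polyhedral function, in a single direction. -/
theorem exists_inner_le_mul_of_isEpiPolyhedral {f : F → EReal} (hf : IsEpiPolyhedral f)
    {p u q : F} {r : ℝ} (hu : f u ≤ r)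
    (h : ∀ z (t : ℝ), f z ≤ t → t ≤ r + inner ℝ p (z - u) → inner ℝ q (z - u) ≤ 0) :
    ∃ M : ℝ, 0 ≤ M ∧ ∀ z (t : ℝ), f z ≤ t →
      inner ℝ q (z - u) ≤ M * (t - r - inner ℝ p (z - u)) := by
  classical
  obtain ⟨k, a, c, b, hepi⟩ := hf.exists_halfspaces
  -- Farkas data on directions `(w, ρ)` at `(u, r)`: `none` says that `f - ⟨p, ·⟩` does not
  -- increase, the others are the active constraints. Inactive constraints are set to zero, since
  -- short steps cannot violate them.
  let A : Option (Fin k) → (F × ℝ) →ₗ[ℝ] ℝ := fun o => o.elim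
    (LinearMap.snd ℝ F ℝ - (innerₛₗ ℝ p) ∘ₗ LinearMap.fst ℝ F ℝ)
    (fun i => if inner ℝ (a i) u + c i * r = b i then
      (innerₛₗ ℝ (a i)) ∘ₗ LinearMap.fst ℝ F ℝ + c i • LinearMap.snd ℝ F ℝ else 0)
  have hA : ∀ v, (∀ i ∈ Finset.univ, A i v ≤ 0) → ((innerₛₗ ℝ q) ∘ₗ LinearMap.fst ℝ F ℝ) v ≤ 0 := by
    rintro ⟨w, ρ⟩ hv
    have h0 := hv none (Finset.mem_univ _)
    have hi := fun i => hv (some i) (Finset.mem_univ _)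
    simp only [A, Option.elim, LinearMap.sub_apply, LinearMap.comp_apply, LinearMap.fst_apply,
      innerₛₗ_apply_apply, LinearMap.snd_apply] at h0 hi ⊢
    obtain ⟨t, ht, htmem⟩ : ∃ t : ℝ, 0 < t ∧ f (u + t • w) ≤ ((r + t * ρ : ℝ) : EReal) := by
      have : ∀ᶠ t : ℝ in 𝓝[>] 0, ∀ i, inner ℝ (a i) (u + t • w) + c i * (r + t * ρ) ≤ b i := by
        rw [eventually_all]
        intro i
        by_cases hact : inner ℝ (a i) u + c i * r = b i
        · have h2 := hi i
          rw [if_pos hact] at h2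
          simp only [LinearMap.add_apply, LinearMap.comp_apply, LinearMap.fst_apply,
            innerₛₗ_apply_apply, LinearMap.smul_apply, LinearMap.snd_apply, smul_eq_mul] at h2
          filter_upwards [self_mem_nhdsWithin] with t ht
          have := mul_nonpos_of_nonneg_of_nonpos (le_of_lt ht) h2
          rw [inner_add_right, real_inner_smul_right]
          linarith
        · have hlt : inner ℝ (a i) (u + (0 : ℝ) • w) + c i * (r + 0 * ρ) < b i := by
            simpa using lt_of_le_of_ne ((hepi u r).1 hu i) hact
          have hc : Continuous fun t : ℝ => inner ℝ (a i) (u + t • w) + c i * (r + t * ρ) := by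
            fun_prop
          exact ((hc.tendsto 0).eventually (gt_mem_nhds hlt)).filter_mono nhdsWithin_le_nhds
            |>.mono fun _ => le_of_lt
      obtain ⟨t, h1, h2⟩ := (this.and self_mem_nhdsWithin).exists
      exact ⟨t, h2, (hepi _ _).2 h1⟩
    have := h _ _ htmem
    rw [add_sub_cancel_left, real_inner_smul_right, real_inner_smul_right] at this
    have h3 := this (by nlinarith)
    nlinarith
  obtain ⟨μ, hμ, e⟩ := exists_nonneg_sum_eq_of_forall_nonpos Finset.univ A _ hA
  -- The active constraints contribute nonpositive terms, so the multiplier of the gap functional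
  -- alone is the constant.
  refine ⟨μ none, hμ none, fun z t hz => ?_⟩
  have e1 := e (z - u, t - r)
  rw [Fintype.sum_option] at e1
  have h1 : ∑ i : Fin k, μ (some i) * A (some i) (z - u, t - r) ≤ 0 := by
    refine Finset.sum_nonpos fun i _ => mul_nonpos_of_nonneg_of_nonpos (hμ _) ?_
    simp only [A, Option.elim]
    split_ifs with hi
    · have := (hepi z t).1 hz i
      simp only [LinearMap.add_apply, LinearMap.comp_apply, LinearMap.fst_apply,
        innerₛₗ_apply_apply, LinearMap.smul_apply, LinearMap.snd_apply, smul_eq_mul,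
        inner_sub_right]
      linarith
    · simp
  simp only [A, Option.elim, LinearMap.sub_apply, LinearMap.comp_apply, LinearMap.fst_apply,
    innerₛₗ_apply_apply, LinearMap.snd_apply] at e1 h1
  rw [e1]
  linarith

/-- Near a point `u₀` of the relative interior of `∂f*(p₀)`, the graph of `∂f*` contains a
neighborhood of `(p₀, u₀)` in the product of the normal space and the tangent space. -/
theorem exists_forall_mem_subdifferential_conjugate [FiniteDimensional ℝ F] {f : F → EReal}
    (hf : IsEpiPolyhedral f) (hp : IsProper f) {p₀ u₀ : F}
    (hu₀ : u₀ ∈ intrinsicInterior ℝ (subdifferential (conjugate f) p₀)) :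
    ∃ ε > 0, ∀ p u, p - p₀ ∈ (vectorSpan ℝ (subdifferential (conjugate f) p₀))ᗮ →
      u - u₀ ∈ vectorSpan ℝ (subdifferential (conjugate f) p₀) →
      ‖p - p₀‖ < ε → ‖u - u₀‖ < ε → u ∈ subdifferential (conjugate f) p := by
  set L := vectorSpan ℝ (subdifferential (conjugate f) p₀)
  have hmem := intrinsicInterior_subset hu₀
  obtain ⟨φ, hφ, hsub⟩ := mem_subdifferential_conjugate.1 hmem
  obtain ⟨ε₁, hε₁, hball⟩ := exists_ball_subset_of_mem_intrinsicInterior hu₀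
  have hFen : ∀ z (t : ℝ), f z ≤ t → inner ℝ z p₀ - t ≤ φ := conjugate_le_coe_iff.1 hφ.le
  have hval := fun u hu => le_of_mem_subdifferential_conjugate hf hp (u := u) hφ hu
  -- The bracket is the Fenchel–Young gap `t + φ - ⟨z, p₀⟩`. Where it is nonpositive, `z ∈ ∂f*(p₀)`,
  -- so `q ∈ Lᗮ` vanishes on `z - u₀`.
  have hdir : ∀ q ∈ Lᗮ, ∃ M : ℝ, 0 ≤ M ∧ ∀ z (t : ℝ), f z ≤ t →
      inner ℝ q (z - u₀) ≤ M * (t - (inner ℝ u₀ p₀ - φ) - inner ℝ p₀ (z - u₀)) := by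
    intro q hq
    refine exists_inner_le_mul_of_isEpiPolyhedral hf (hval u₀ hmem) fun z t hz ht => ?_
    rw [inner_sub_right, real_inner_comm z, real_inner_comm u₀] at ht
    have hz' : z ∈ subdifferential (conjugate f) p₀ := by
      refine mem_subdifferential_conjugate_of_le hz fun z' t' h' => ?_
      have := hFen z' t' h'
      rw [inner_sub_right, real_inner_comm z', real_inner_comm z]
      linarith
    exact ((Submodule.mem_orthogonal' _ _).1 hq _ (vsub_mem_vectorSpan ℝ hz' hmem)).le
  -- The constant depends on the direction; an orthonormal basis, taken with both signs, makes it
  -- uniform over `Lᗮ`.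
  let e := stdOrthonormalBasis ℝ Lᗮ
  have hdir' : ∀ j, ∃ M : ℝ, 0 ≤ M ∧ ∀ z (t : ℝ), f z ≤ t →
      |inner ℝ (e j : F) (z - u₀)| ≤ M * (t - (inner ℝ u₀ p₀ - φ) - inner ℝ p₀ (z - u₀)) := by
    intro j
    obtain ⟨M₁, hM₁, h₁⟩ := hdir (e j) (e j).2
    obtain ⟨M₂, hM₂, h₂⟩ := hdir (-(e j : F)) (Submodule.neg_mem _ (e j).2)
    refine ⟨M₁ + M₂, by positivity, fun z t hz => ?_⟩
    have hη : 0 ≤ t - (inner ℝ u₀ p₀ - φ) - inner ℝ p₀ (z - u₀) := by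
      have := hFen z t hz
      rw [inner_sub_right, real_inner_comm z, real_inner_comm u₀]
      linarith
    have a₁ := h₁ z t hz
    have a₂ := h₂ z t hz
    rw [inner_neg_left] at a₂
    rw [abs_le]
    constructor <;> nlinarith [mul_nonneg hM₁ hη, mul_nonneg hM₂ hη]
  choose M hM hbd using hdir'
  have hS : 0 ≤ ∑ j, M j := Finset.sum_nonneg fun j _ => hM j
  -- The first bound keeps `u` in `∂f*(p₀)`; the second makes the tilt `⟨p - p₀, z - u₀⟩` at most
  -- the gap. The `+ 1` covers a zero sum.
  refine ⟨min ε₁ (1 / (∑ j, M j + 1)), by positivity, fun p u hp' hu' hpn hun => ?_⟩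
  have huC := hball u hu' (hun.trans_le (min_le_left _ _))
  refine mem_subdifferential_conjugate_of_le (hval u huC) fun z t hz => ?_
  have hη : 0 ≤ t - (inner ℝ u₀ p₀ - φ) - inner ℝ p₀ (z - u₀) := by
    have := hFen z t hz
    rw [inner_sub_right, real_inner_comm z, real_inner_comm u₀]
    linarith
  have hq : inner ℝ (p - p₀) (z - u₀) ≤ t - (inner ℝ u₀ p₀ - φ) - inner ℝ p₀ (z - u₀) := by
    have h1 : p - p₀ = ∑ j, (inner ℝ (e j : F) (p - p₀)) • (e j : F) := by
      have := congrArg Subtype.val (e.sum_repr' ⟨p - p₀, hp'⟩)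
      simpa using this.symm
    have h2 : ∀ j, inner ℝ (e j : F) (p - p₀) * inner ℝ (e j : F) (z - u₀) ≤
        (1 / (∑ j, M j + 1)) * (M j * (t - (inner ℝ u₀ p₀ - φ) - inner ℝ p₀ (z - u₀))) := by
      intro j
      refine (le_abs_self _).trans ?_
      rw [abs_mul]
      refine mul_le_mul ?_ (hbd j z t hz) (abs_nonneg _) (by positivity)
      refine (abs_real_inner_le_norm _ _).trans ?_
      have : ‖(e j : F)‖ = 1 := by
        exact e.norm_eq_one j
      rw [this, one_mul]
      exact (hpn.trans_le (min_le_right _ _)).le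
    rw [h1, sum_inner]
    simp only [real_inner_smul_left]
    refine (Finset.sum_le_sum fun j _ => h2 j).trans ?_
    rw [← Finset.mul_sum, ← Finset.sum_mul, ← mul_assoc]
    refine mul_le_of_le_one_left hη ?_
    rw [one_div, inv_mul_le_iff₀ (by positivity)]
    linarith
  have horth : inner ℝ (p - p₀) (u - u₀) = 0 := (Submodule.mem_orthogonal' _ _).1 hp' _ hu'
  have e1 : inner ℝ u p₀ = inner ℝ p₀ u := real_inner_comm _ _
  have e2 : inner ℝ u₀ p₀ = inner ℝ p₀ u₀ := real_inner_comm _ _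
  simp only [inner_sub_left, inner_sub_right, e1, e2] at hq horth ⊢
  linarith

/-- Moving along `-e_i` does not increase `f`, so a negative `p i` would make the supremum infinite.
-/
theorem nonneg_of_conjugate_ne_top {ι : Type*} [Fintype ι] {f : Vec ι → EReal}
    (hp : IsProper f) (hmono : IsNondecreasing f) {p : Vec ι} {r : ℝ} (hr : conjugate f p = r)
    (i : ι) : 0 ≤ p i := by
  classical
  obtain ⟨z₀, t₀, h₀⟩ := hp.exists_coe
  by_contra hcon
  push Not at hcon
  have key : ∀ t : ℝ, 0 ≤ t → inner ℝ z₀ p - t * p i - t₀ ≤ r := by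
    intro t ht
    have h1 : f (z₀ - t • EuclideanSpace.single i 1) ≤ t₀ := by
      rw [← h₀]
      refine hmono _ _ fun j => ?_
      simp only [PiLp.sub_apply, PiLp.smul_apply, smul_eq_mul, sub_le_self_iff]
      refine mul_nonneg ht ?_
      rw [PiLp.single_apply]
      split_ifs <;> norm_num
    have := conjugate_le_coe_iff.1 hr.le _ _ h1
    rw [inner_sub_left, real_inner_smul_left, EuclideanSpace.inner_single_left] at this
    simpa using this
  have h0 := key 0 le_rfl
  have h1 := key ((r - inner ℝ z₀ p + t₀ + 1) / (-p i)) (div_nonneg (by linarith) (by linarith))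
  have : (r - inner ℝ z₀ p + t₀ + 1) / (-p i) * p i = -(r - inner ℝ z₀ p + t₀ + 1) := by
    have := hcon.ne
    field_simp
  linarith

end Polyhedral

/-! ### An implicit function theorem relative to a subspace -/

section ProjectedEquation

variable {X E : Type*} [NormedAddCommGroup X] [InnerProductSpace ℝ X] [FiniteDimensional ℝ X]
  [NormedAddCommGroup E] [InnerProductSpace ℝ E] [FiniteDimensional ℝ E]

/-- The summands lie in `W` and `Wᗮ`, so both vanish: one `E`-valued equation encodes the two
membership conditions. -/
theorem mem_of_starProjection_add_sub_eq_zero {W : Submodule ℝ E} {a w : E}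
    (h : W.starProjection a + (w - W.starProjection w) = 0) : w ∈ W ∧ a ∈ Wᗮ := by
  have hw : w ∈ W := by
    have : w = W.starProjection w - W.starProjection a := by
      rw [eq_sub_iff_add_eq, ← sub_eq_zero, ← h]
      abel
    rw [this]
    exact W.sub_mem (Submodule.starProjection_apply_mem _ _)
      (Submodule.starProjection_apply_mem _ _)
  rw [Submodule.starProjection_eq_self_iff.2 hw, sub_self, add_zero] at h
  exact ⟨hw, (Submodule.starProjection_apply_eq_zero_iff _).1 h⟩

/-- Implicit function theorem for the equation `Ψ (x, v) - Ψ (x₀, v₀) ∈ Wᗮ` in the unknown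
`v ∈ v₀ + W`. -/
theorem exists_implicit_of_projected_injective {Ψ : X × E → E} (hΨ : ContDiff ℝ 1 Ψ)
    (W : Submodule ℝ E) (x₀ : X) (v₀ : E)
    (hinj : ∀ w ∈ W, fderiv ℝ Ψ (x₀, v₀) (0, w) ∈ Wᗮ → w = 0) :
    ∃ S : X → E, ContDiffAt ℝ 1 S x₀ ∧ S x₀ = v₀ ∧
      (∀ᶠ x in 𝓝 x₀, S x - v₀ ∈ W ∧ Ψ (x, S x) - Ψ (x₀, v₀) ∈ Wᗮ) ∧
      ∀ ξ, fderiv ℝ S x₀ ξ ∈ W ∧ fderiv ℝ Ψ (x₀, v₀) (ξ, fderiv ℝ S x₀ ξ) ∈ Wᗮ := by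
  set P := W.starProjection
  set D := fderiv ℝ Ψ (x₀, v₀)
  let H : X × E → E := fun q => P (Ψ q - Ψ (x₀, v₀)) + ((q.2 - v₀) - P (q.2 - v₀))
  have hH : ContDiff ℝ 1 H := by
    refine (P.contDiff.comp (hΨ.sub contDiff_const)).add
      ((contDiff_snd.sub contDiff_const).sub (P.contDiff.comp (contDiff_snd.sub contDiff_const)))
  have hΨd : HasFDerivAt Ψ D (x₀, v₀) := (hΨ.differentiable one_ne_zero _).hasFDerivAt
  have hHd : HasFDerivAt H (P ∘L D + (.snd ℝ X E - P ∘L .snd ℝ X E)) (x₀, v₀) := by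
    have h2 : HasFDerivAt (fun q : X × E => q.2 - v₀) (.snd ℝ X E) (x₀, v₀) :=
      hasFDerivAt_snd.sub_const _
    exact (P.hasFDerivAt.comp (x₀, v₀) (hΨd.sub_const _)).add
      (h2.sub (P.hasFDerivAt.comp (x₀, v₀) h2))
  have hH0 : H (x₀, v₀) = 0 := by simp [H]
  have hinv : (fderiv ℝ H (x₀, v₀) ∘L .inr ℝ X E).IsInvertible := by
    rw [hHd.fderiv]
    set T := (P ∘L D + (.snd ℝ X E - P ∘L .snd ℝ X E)) ∘L ContinuousLinearMap.inr ℝ X E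
    have hT : Function.Injective T.toLinearMap := by
      refine (injective_iff_map_eq_zero _).2 fun w hw => ?_
      have := mem_of_starProjection_add_sub_eq_zero (W := W) (a := D (0, w)) (w := w) hw
      exact hinj w this.1 this.2
    refine ⟨(LinearEquiv.ofInjectiveEndo _ hT).toContinuousLinearEquiv, ?_⟩
    ext w
    rfl
  have hHa : ContDiffAt ℝ 1 H (x₀, v₀) := hH.contDiffAt
  set S := hHa.implicitFunction one_ne_zero hinv
  have hSc : ContDiffAt ℝ 1 S x₀ := hHa.contDiffAt_implicitFunction one_ne_zero hinv
  have hS0 : S x₀ = v₀ := hHa.implicitFunction_apply_self one_ne_zero hinv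
  have hev : ∀ᶠ x in 𝓝 x₀, H (x, S x) = 0 := by
    have := hHa.eventually_apply_implicitFunction one_ne_zero hinv
    rwa [hH0] at this
  refine ⟨S, hSc, hS0, ?_, fun ξ => ?_⟩
  · filter_upwards [hev] with x hx
    exact mem_of_starProjection_add_sub_eq_zero hx
  · have hSd : HasFDerivAt S (fderiv ℝ S x₀) x₀ :=
      (hSc.differentiableAt one_ne_zero).hasFDerivAt
    have hHd' : HasFDerivAt H (P ∘L D + (.snd ℝ X E - P ∘L .snd ℝ X E)) (x₀, S x₀) := by
      rwa [hS0]
    have hc := hHd'.comp x₀ ((hasFDerivAt_id x₀).prodMk hSd)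
    have hz : HasFDerivAt (H ∘ fun x => (id x, S x)) (0 : X →L[ℝ] E) x₀ :=
      (hasFDerivAt_const 0 x₀).congr_of_eventuallyEq hev
    have := DFunLike.congr_fun (hc.unique hz) ξ
    exact mem_of_starProjection_add_sub_eq_zero this

end ProjectedEquation

/-! ### Compression of a matrix to a subspace with a given basis -/

section Matrices

theorem inner_toLp_toLp {ι : Type*} [Fintype ι] (a b : ι → ℝ) :
    inner ℝ (WithLp.toLp 2 a : Vec ι) (WithLp.toLp 2 b) = a ⬝ᵥ b := by
  simp [PiLp.inner_apply, dotProduct, mul_comm]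

theorem ColumnsFormBasis.mem_iff {ι : Type*} {k : ℕ} {B : Matrix ι (Fin k) ℝ}
    {W : Submodule ℝ (Vec ι)} (hB : ColumnsFormBasis B W) (w : Vec ι) :
    w ∈ W ↔ ∃ c : Fin k → ℝ, WithLp.toLp 2 (B.mulVec c) = w := by
  rw [← hB.2, Submodule.mem_span_range_iff_exists_fun]
  refine exists_congr fun c => ?_
  have : (WithLp.toLp 2 (B.mulVec c) : Vec ι) = ∑ j, c j • WithLp.toLp 2 (B.col j) := by
    ext i
    simp [Matrix.mulVec, dotProduct, Matrix.col, mul_comm]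
  rw [this]

theorem ColumnsFormBasis.eq_zero_of_mulVec {ι : Type*} {k : ℕ} {B : Matrix ι (Fin k) ℝ}
    {W : Submodule ℝ (Vec ι)} (hB : ColumnsFormBasis B W) {c : Fin k → ℝ}
    (hc : B.mulVec c = 0) : c = 0 := by
  refine funext (Fintype.linearIndependent_iff.1 hB.1 c ?_)
  have : (WithLp.toLp 2 (B.mulVec c) : Vec ι) = ∑ j, c j • WithLp.toLp 2 (B.col j) := by
    ext i
    simp [Matrix.mulVec, dotProduct, Matrix.col, mul_comm]
  rw [← this, hc]
  rfl

variable {ι κ : Type*} [Fintype ι] [Fintype κ]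

theorem toLp_jacobian_mulVec [DecidableEq ι] (Φ : Vec ι → Vec κ) (x ξ : Vec ι) :
    (WithLp.toLp 2 ((jacobian Φ x).mulVec ξ) : Vec κ) = fderiv ℝ Φ x ξ := by
  ext k
  have hξ : ξ = ∑ i, ξ i • EuclideanSpace.single i (1 : ℝ) := by
    ext j
    simp [Pi.single_apply]
  conv_rhs => rw [hξ, map_sum]
  simp [jacobian, Matrix.mulVec, dotProduct, mul_comm]

variable {k : ℕ} {B : Matrix ι (Fin k) ℝ} {W : Submodule ℝ (Vec ι)}

/-- `Bᵀ` kills exactly `Wᗮ`, so a kernel vector `c` gives `w = Bc ∈ W` with `Kw ∈ Wᗮ`. -/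
theorem ColumnsFormBasis.isUnit_transpose_mul_mul (hB : ColumnsFormBasis B W)
    {K : Matrix ι ι ℝ} (hK : ∀ w ∈ W, WithLp.toLp 2 (K.mulVec w) ∈ Wᗮ → w = 0) :
    IsUnit (B.transpose * K * B) := by
  rw [← Matrix.mulVec_injective_iff_isUnit]
  refine (injective_iff_map_eq_zero (Matrix.mulVecLin (B.transpose * K * B))).2 fun c hc => ?_
  rw [Matrix.mulVecLin_apply] at hc
  have h0 := hK (WithLp.toLp 2 (B.mulVec c)) ((hB.mem_iff _).2 ⟨c, rfl⟩) ?_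
  · exact hB.eq_zero_of_mulVec (by simpa using h0)
  · rw [Submodule.mem_orthogonal]
    intro u hu
    obtain ⟨d, rfl⟩ := (hB.mem_iff u).1 hu
    rw [inner_toLp_toLp, ← Matrix.vecMul_transpose, ← Matrix.dotProduct_mulVec,
      Matrix.mulVec_mulVec, Matrix.mulVec_mulVec, hc, dotProduct_zero]

/-- Substitute `Jξ = Bc`, apply `Bᵀ` to remove the `Wᗮ` part, and solve for `c`. -/
theorem ColumnsFormBasis.eq_neg_mul_inv_mul [DecidableEq κ] (hB : ColumnsFormBasis B W)
    {K : Matrix ι ι ℝ} (hK : IsUnit (B.transpose * K * B)) {J Q : Matrix ι κ ℝ}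
    (hJ : ∀ ξ : κ → ℝ, WithLp.toLp 2 (J.mulVec ξ) ∈ W)
    (hQ : ∀ ξ : κ → ℝ, WithLp.toLp 2 (Q.mulVec ξ + K.mulVec (J.mulVec ξ)) ∈ Wᗮ) :
    J = -(B * (B.transpose * K * B)⁻¹ * B.transpose * Q) := by
  refine Matrix.ext_of_mulVec_single fun i => ?_
  set ξ : κ → ℝ := Pi.single i 1
  obtain ⟨c, hc⟩ := (hB.mem_iff _).1 (hJ ξ)
  have hc' : B.mulVec c = J.mulVec ξ := congrArg WithLp.ofLp hc
  have horth : B.transpose.mulVec (Q.mulVec ξ + K.mulVec (J.mulVec ξ)) = 0 := by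
    refine dotProduct_eq_zero _ fun d => ?_
    rw [dotProduct_comm, Matrix.dotProduct_mulVec, Matrix.vecMul_transpose, ← inner_toLp_toLp]
    exact (Submodule.mem_orthogonal _ _).1 (hQ ξ) _ ((hB.mem_iff _).2 ⟨d, rfl⟩)
  have hdet := (Matrix.isUnit_iff_isUnit_det _).1 hK
  have h1 : (B.transpose * K * B).mulVec c = -(B.transpose * Q).mulVec ξ := by
    rw [← Matrix.mulVec_mulVec, hc', ← Matrix.mulVec_mulVec, ← Matrix.mulVec_mulVec,
      eq_neg_iff_add_eq_zero, add_comm, ← Matrix.mulVec_add, horth]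
  have h2 : c = -((B.transpose * K * B)⁻¹ * (B.transpose * Q)).mulVec ξ := by
    rw [← Matrix.mulVec_mulVec, ← Matrix.mulVec_neg, ← h1, Matrix.mulVec_mulVec,
      Matrix.nonsing_inv_mul _ hdet, Matrix.one_mulVec]
  rw [← hc', h2, Matrix.mulVec_neg, Matrix.mulVec_mulVec, Matrix.neg_mulVec]
  simp only [Matrix.mul_assoc]

end Matrices

/-! ### Gradient inequality and strong monotonicity -/

section Convex

variable {F : Type*} [NormedAddCommGroup F] [InnerProductSpace ℝ F]

/-- The gradient inequality for a differentiable convex function. -/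
theorem _root_.ConvexOn.add_fderiv_le {f : F → ℝ} (hf : ConvexOn ℝ univ f) {y : F} {f' : F →L[ℝ] ℝ}
    (hd : HasFDerivAt f f' y) (y' : F) : f y + f' (y' - y) ≤ f y' := by
  have hl : HasDerivAt (fun t : ℝ => f (AffineMap.lineMap y y' t)) (f' (y' - y)) 0 := by
    have h0 : HasFDerivAt f f' (AffineMap.lineMap y y' (0 : ℝ)) := by simpa using hd
    exact h0.comp_hasDerivAt 0 AffineMap.hasDerivAt_lineMap
  have hc : ConvexOn ℝ univ fun t : ℝ => f (AffineMap.lineMap y y' t) := by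
    have := hf.comp_affineMap (AffineMap.lineMap (k := ℝ) y y')
    rwa [preimage_univ] at this
  have := hc.le_slope_of_hasDerivAt (mem_univ 0) (mem_univ 1) zero_lt_one hl
  simp only [slope_def_field, AffineMap.lineMap_apply_zero, AffineMap.lineMap_apply_one, sub_zero,
    div_one] at this
  linarith

/-- The derivative of a strongly monotone map is coercive. -/
theorem inner_fderiv_ge_of_strongly_monotone {M : F → F} {c : ℝ}
    (hM : ∀ y y', c * ‖y' - y‖ ^ 2 ≤ inner ℝ (M y' - M y) (y' - y)) {y : F}
    (hd : DifferentiableAt ℝ M y) (η : F) : c * ‖η‖ ^ 2 ≤ inner ℝ (fderiv ℝ M y η) η := by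
  have hl : HasDerivAt (fun t : ℝ => M (y + t • η)) (fderiv ℝ M y η) 0 := by
    have h0 : HasFDerivAt M (fderiv ℝ M y) (y + (0 : ℝ) • η) := by simpa using hd.hasFDerivAt
    have h1 : HasDerivAt (fun t : ℝ => y + t • η) η 0 := by
      simpa using ((hasDerivAt_id (0 : ℝ)).smul_const η).const_add y
    exact h0.comp_hasDerivAt 0 h1
  have h2 := (hasDerivAt_iff_tendsto_slope_zero.1 hl).inner (𝕜 := ℝ)
    (tendsto_const_nhds (x := η) (f := 𝓝[≠] (0 : ℝ)))
  refine ge_of_tendsto h2 ?_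
  filter_upwards [self_mem_nhdsWithin] with t ht
  have ht : t ≠ 0 := ht
  have h3 := hM y (y + t • η)
  rw [add_sub_cancel_left, norm_smul, real_inner_smul_right, mul_pow, Real.norm_eq_abs, sq_abs]
    at h3
  rw [real_inner_smul_left, zero_add, zero_smul, add_zero]
  have h4 : 0 < t ^ 2 := by positivity
  -- Dividing by `t ^ 2` instead of `t` treats both signs of `t` together.
  have h5 : t⁻¹ * inner ℝ (M (y + t • η) - M y) η =
      (t * inner ℝ (M (y + t • η) - M y) η) / t ^ 2 := by
    field_simp
  rw [h5, le_div_iff₀ h4]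
  linarith

end Convex

/-! ### Splitting of primal-dual vectors -/

section PrimalDual

variable {m s : ℕ}

@[simp]
theorem primalPart_pair (y : Vec (Fin m)) (p : Vec (Fin s)) : primalPart (pair y p) = y := rfl

@[simp]
theorem dualPart_pair (y : Vec (Fin m)) (p : Vec (Fin s)) : dualPart (pair y p) = p := rfl

@[simp]
theorem pair_primalPart_dualPart (v : Vec (Fin m ⊕ Fin s)) :
    pair (primalPart v) (dualPart v) = v := by
  ext (i | i) <;> rfl

/-- The projection `(y, p) ↦ y`. -/
noncomputable def primalCLM (m s : ℕ) : Vec (Fin m ⊕ Fin s) →L[ℝ] Vec (Fin m) :=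
  LinearMap.toContinuousLinearMap
    { toFun := primalPart, map_add' := fun _ _ => rfl, map_smul' := fun _ _ => rfl }

/-- The projection `(y, p) ↦ p`. -/
noncomputable def dualCLM (m s : ℕ) : Vec (Fin m ⊕ Fin s) →L[ℝ] Vec (Fin s) :=
  LinearMap.toContinuousLinearMap
    { toFun := dualPart, map_add' := fun _ _ => rfl, map_smul' := fun _ _ => rfl }

/-- The map `(y, p) ↦ (y, p)` on the product space. -/
noncomputable def pairCLM (m s : ℕ) : Vec (Fin m) × Vec (Fin s) →L[ℝ] Vec (Fin m ⊕ Fin s) :=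
  LinearMap.toContinuousLinearMap
    { toFun := fun q => pair q.1 q.2
      map_add' := fun _ _ => by ext (i | i) <;> rfl
      map_smul' := fun _ _ => by ext (i | i) <;> rfl }

@[simp]
theorem primalCLM_apply (v : Vec (Fin m ⊕ Fin s)) : primalCLM m s v = primalPart v := rfl

@[simp]
theorem dualCLM_apply (v : Vec (Fin m ⊕ Fin s)) : dualCLM m s v = dualPart v := rfl

theorem inner_eq_primal_add_dual (v w : Vec (Fin m ⊕ Fin s)) :
    inner ℝ v w =
      inner ℝ (primalPart v) (primalPart w) + inner ℝ (dualPart v) (dualPart w) := by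
  simp [PiLp.inner_apply, primalPart, dualPart]

theorem primalPart_sub (v w : Vec (Fin m ⊕ Fin s)) :
    primalPart (v - w) = primalPart v - primalPart w := rfl

theorem dualPart_sub (v w : Vec (Fin m ⊕ Fin s)) :
    dualPart (v - w) = dualPart v - dualPart w := rfl

theorem mem_subdifferential_hTilde {h : Vec (Fin s) → EReal} {v u : Vec (Fin m ⊕ Fin s)} :
    u ∈ subdifferential (hTilde (m := m) h) v ↔
      primalPart u = 0 ∧ dualPart u ∈ subdifferential (conjugate h) (dualPart v) := by
  rw [mem_subdifferential_conjugate]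
  refine (mem_subdifferential_conjugate_comp h (dualCLM m s)).trans ?_
  simp only [dualCLM_apply, inner_eq_primal_add_dual, primalPart_sub, dualPart_sub]
  constructor
  · rintro ⟨r, hr, H⟩
    refine ⟨?_, r, hr, fun p' t ht => ?_⟩
    -- `h̃` ignores `y`, so shifting `y` by `primalPart u` gives `‖primalPart u‖² ≤ 0`.
    · have := H (pair (primalPart v + primalPart u) (dualPart v)) r hr.le
      simpa using this
    · simpa using H (pair (primalPart v) p') t ht
  · rintro ⟨h0, r, hr, H⟩
    refine ⟨r, hr, fun v' t ht => ?_⟩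
    rw [h0, inner_zero_left, zero_add]
    exact H _ t ht

end PrimalDual

/-! ### Partial derivatives -/

section PartialDerivatives

variable {X Y Z : Type*} [NormedAddCommGroup X] [NormedSpace ℝ X] [NormedAddCommGroup Y]
  [NormedSpace ℝ Y] [NormedAddCommGroup Z] [NormedSpace ℝ Z]

theorem hasFDerivAt_comp_prodMk_right {f : X × Y → Z} (hf : Differentiable ℝ f) (x : X) (y : Y) :
    HasFDerivAt (fun y' => f (x, y')) (fderiv ℝ f (x, y) ∘L .inr ℝ X Y) y :=
  (hf (x, y)).hasFDerivAt.comp y (hasFDerivAt_prodMk_right x y)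

theorem hasFDerivAt_comp_prodMk_left {f : X × Y → Z} (hf : Differentiable ℝ f) (x : X) (y : Y) :
    HasFDerivAt (fun x' => f (x', y)) (fderiv ℝ f (x, y) ∘L .inl ℝ X Y) x :=
  (hf (x, y)).hasFDerivAt.comp x (hasFDerivAt_prodMk_left x y)

end PartialDerivatives

/-! ### Optimality system, uniqueness and smoothness of `ψ` -/

section LowerLevel

variable {n m s : ℕ} {g : Vec (Fin n) × Vec (Fin m) → ℝ}
  {G : Vec (Fin n) × Vec (Fin m) → Vec (Fin s)} {h : Vec (Fin s) → EReal} {α β : ℝ}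

/-- The gradient in `y` of `g(x, y) + ⟨G(x, y), p⟩`. -/
noncomputable def gradSum (g : Vec (Fin n) × Vec (Fin m) → ℝ)
    (G : Vec (Fin n) × Vec (Fin m) → Vec (Fin s)) (x : Vec (Fin n)) (y : Vec (Fin m))
    (p : Vec (Fin s)) : Vec (Fin m) :=
  gradY g x y + WithLp.toLp 2 ((jacY G x y).transpose.mulVec p)

theorem primalPart_neg_psi (x : Vec (Fin n)) (v : Vec (Fin m ⊕ Fin s)) :
    primalPart (-psi g G α β x v) =
      gradSum g G x (primalPart v) (dualPart v) + β • primalPart v := by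
  have : primalPart (-psi g G α β x v) = -primalPart (psi g G α β x v) := rfl
  rw [this, psi, primalPart_pair, gradSum]
  abel

theorem dualPart_neg_psi (x : Vec (Fin n)) (v : Vec (Fin m ⊕ Fin s)) :
    dualPart (-psi g G α β x v) = G (x, primalPart v) - α • dualPart v := by
  have : dualPart (-psi g G α β x v) = -dualPart (psi g G α β x v) := rfl
  rw [this, psi, dualPart_pair]
  abel

theorem mem_solutionMap_iff {x : Vec (Fin n)} {v : Vec (Fin m ⊕ Fin s)} :
    v ∈ solutionMap g G h α β x ↔
      gradSum g G x (primalPart v) (dualPart v) + β • primalPart v = 0 ∧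
        G (x, primalPart v) - α • dualPart v ∈ subdifferential (conjugate h) (dualPart v) := by
  rw [← primalPart_neg_psi (g := g) (G := G) (α := α), ← dualPart_neg_psi (g := g) (β := β),
    ← mem_subdifferential_hTilde]
  constructor
  · rintro ⟨u, hu, h0⟩
    rwa [neg_eq_of_add_eq_zero_right h0.symm]
  · exact fun hu => ⟨_, hu, (add_neg_cancel _).symm⟩

theorem inner_gradY (hg : Differentiable ℝ g) (x : Vec (Fin n)) (y w : Vec (Fin m)) :
    inner ℝ (gradY g x y) w = fderiv ℝ g (x, y) (0, w) := by
  rw [gradY, gradient, InnerProductSpace.toDual_symm_apply,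
    (hasFDerivAt_comp_prodMk_right hg x y).fderiv]
  rfl

theorem toLp_jacY_mulVec (hG : Differentiable ℝ G) (x : Vec (Fin n)) (y w : Vec (Fin m)) :
    WithLp.toLp 2 ((jacY G x y).mulVec w) = fderiv ℝ G (x, y) (0, w) := by
  rw [jacY, toLp_jacobian_mulVec, (hasFDerivAt_comp_prodMk_right hG x y).fderiv]
  rfl

theorem inner_transpose_mulVec {ι κ : Type*} [Fintype ι] [Fintype κ] (M : Matrix κ ι ℝ)
    (p : Vec κ) (w : Vec ι) :
    inner ℝ (WithLp.toLp 2 (M.transpose.mulVec p) : Vec ι) w =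
      inner ℝ p (WithLp.toLp 2 (M.mulVec w)) := by
  have h1 := inner_toLp_toLp (M.transpose.mulVec p) w
  have h2 := inner_toLp_toLp p (M.mulVec w)
  rw [Matrix.dotProduct_mulVec, ← Matrix.mulVec_transpose] at h2
  exact h1.trans h2.symm

theorem hasFDerivAt_sum (hg : Differentiable ℝ g) (hG : Differentiable ℝ G) (x : Vec (Fin n))
    (y : Vec (Fin m)) (p : Vec (Fin s)) :
    HasFDerivAt (fun y' => g (x, y') + inner ℝ (G (x, y')) p) (innerSL ℝ (gradSum g G x y p)) y := by
  have h1 := (hasFDerivAt_comp_prodMk_right hg x y).add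
    ((hasFDerivAt_comp_prodMk_right hG x y).inner ℝ (hasFDerivAt_const p y))
  convert! h1 using 1
  ext w
  rw [innerSL_apply_apply, gradSum, inner_add_left, inner_gradY hg, inner_transpose_mulVec,
    toLp_jacY_mulVec hG, real_inner_comm]
  simp

/-- Finiteness of `h*(p)` makes the Lagrangian real, and `h*(p)` and `α/2 |p|²` are constants in
`y`. -/
theorem gradYLagrangian_eq (hg : Differentiable ℝ g) (hG : Differentiable ℝ G) {p : Vec (Fin s)}
    {r : ℝ} (hr : conjugate h p = r) (x : Vec (Fin n)) (y : Vec (Fin m)) :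
    gradYLagrangian g G h α β x y p = gradSum g G x y p + β • y := by
  have h1 : ∀ y' : Vec (Fin m), (lagrangian g G h α β x y' p).toReal =
      (g (x, y') + inner ℝ (G (x, y')) p) + β / 2 * ‖y'‖ ^ 2 - (r + α / 2 * ‖p‖ ^ 2) := by
    intro y'
    rw [lagrangian, hr, ← EReal.coe_sub, ← EReal.coe_sub, EReal.toReal_coe]
    ring
  rw [gradYLagrangian, funext h1]
  refine HasGradientAt.gradient ?_
  rw [hasGradientAt_iff_hasFDerivAt]
  have h2 := ((hasFDerivAt_sum hg hG x y p).add
    ((hasStrictFDerivAt_norm_sq y).hasFDerivAt.const_mul (β / 2))).sub_const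
      (r + α / 2 * ‖p‖ ^ 2)
  convert! h2 using 1
  ext w
  simp
  ring

theorem convexOn_sum (hg_convex : ∀ x, ConvexOn ℝ univ fun y => g (x, y))
    (hG_convex : ∀ x i, ConvexOn ℝ univ fun y => G (x, y) i) {p : Vec (Fin s)}
    (hp : ∀ i, 0 ≤ p i) (x : Vec (Fin n)) :
    ConvexOn ℝ univ fun y => g (x, y) + inner ℝ (G (x, y)) p := by
  refine (hg_convex x).add ⟨convex_univ, fun y _ y' _ a b ha hb hab => ?_⟩
  simp only [PiLp.inner_apply, RCLike.inner_apply, conj_trivial, smul_eq_mul, Finset.mul_sum]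
  rw [← Finset.sum_add_distrib]
  refine Finset.sum_le_sum fun i _ => ?_
  have h1 := (hG_convex x i).2 (mem_univ y) (mem_univ y') ha hb hab
  have h2 := mul_le_mul_of_nonneg_left h1 (hp i)
  simp only [smul_eq_mul] at h2
  linarith

theorem add_inner_gradSum_le (hg : Differentiable ℝ g) (hG : Differentiable ℝ G)
    (hg_convex : ∀ x, ConvexOn ℝ univ fun y => g (x, y))
    (hG_convex : ∀ x i, ConvexOn ℝ univ fun y => G (x, y) i) {p : Vec (Fin s)}
    (hp : ∀ i, 0 ≤ p i) (x : Vec (Fin n)) (y y' : Vec (Fin m)) :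
    g (x, y) + inner ℝ (G (x, y)) p + inner ℝ (gradSum g G x y p) (y' - y) ≤
      g (x, y') + inner ℝ (G (x, y')) p :=
  (convexOn_sum hg_convex hG_convex hp x).add_fderiv_le (hasFDerivAt_sum hg hG x y p) y'

/-- The primal-dual solution is unique. -/
theorem subsingleton_solutionMap (hg : Differentiable ℝ g) (hG : Differentiable ℝ G)
    (hg_convex : ∀ x, ConvexOn ℝ univ fun y => g (x, y))
    (hG_convex : ∀ x i, ConvexOn ℝ univ fun y => G (x, y) i)
    (h_proper : IsProper h) (h_mono : IsNondecreasing h) (hα : 0 < α) (hβ : 0 < β)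
    (x : Vec (Fin n)) : (solutionMap g G h α β x).Subsingleton := by
  intro v hv v' hv'
  obtain ⟨h1, h2⟩ := mem_solutionMap_iff.1 hv
  obtain ⟨h1', h2'⟩ := mem_solutionMap_iff.1 hv'
  obtain ⟨r, hr, -⟩ := mem_subdifferential_conjugate.1 h2
  obtain ⟨r', hr', -⟩ := mem_subdifferential_conjugate.1 h2'
  have hm := inner_sub_nonneg_of_mem_subdifferential_conjugate h2 h2'
  generalize hy : primalPart v = y at *
  generalize hy' : primalPart v' = y' at *
  generalize hp : dualPart v = p at *
  generalize hp' : dualPart v' = p' at *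
  have c1 := add_inner_gradSum_le hg hG hg_convex hG_convex
    (nonneg_of_conjugate_ne_top h_proper h_mono hr) x y y'
  have c2 := add_inner_gradSum_le hg hG hg_convex hG_convex
    (nonneg_of_conjugate_ne_top h_proper h_mono hr') x y' y
  rw [eq_neg_of_add_eq_zero_left h1] at c1
  rw [eq_neg_of_add_eq_zero_left h1'] at c2
  have e1 : ‖y - y'‖ ^ 2 = inner ℝ y y - 2 * inner ℝ y y' + inner ℝ y' y' := by
    rw [norm_sub_sq_real, real_inner_self_eq_norm_sq, real_inner_self_eq_norm_sq]
  have e2 : ‖p - p'‖ ^ 2 = inner ℝ p p - 2 * inner ℝ p p' + inner ℝ p' p' := by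
    rw [norm_sub_sq_real, real_inner_self_eq_norm_sq, real_inner_self_eq_norm_sq]
  have e3 : inner ℝ y' y = inner ℝ y y' := real_inner_comm _ _
  have e4 : inner ℝ p' p = inner ℝ p p' := real_inner_comm _ _
  simp only [inner_sub_left, inner_sub_right, inner_neg_left, real_inner_smul_left, e3, e4]
    at c1 c2 hm
  -- The two gradient inequalities add up to `⟨G(x, y) - G(x, y'), p - p'⟩ + β‖y - y'‖² ≤ 0`;
  -- monotonicity of `∂h*` bounds the inner product below by `α‖p - p'‖²`.
  have hz : β * ‖y - y'‖ ^ 2 + α * ‖p - p'‖ ^ 2 ≤ 0 := by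
    rw [e1, e2]
    linarith
  have hy0 : ‖y - y'‖ ^ 2 = 0 := by nlinarith [sq_nonneg ‖y - y'‖, sq_nonneg ‖p - p'‖]
  have hp0 : ‖p - p'‖ ^ 2 = 0 := by nlinarith [sq_nonneg ‖y - y'‖, sq_nonneg ‖p - p'‖]
  rw [← pair_primalPart_dualPart v, ← pair_primalPart_dualPart v', hy, hy', hp, hp',
    sub_eq_zero.1 (norm_eq_zero.1 (pow_eq_zero_iff two_ne_zero |>.1 hy0)),
    sub_eq_zero.1 (norm_eq_zero.1 (pow_eq_zero_iff two_ne_zero |>.1 hp0))]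

theorem contDiff_psi (hg : ContDiff ℝ 2 g) (hG : ContDiff ℝ 2 G) (α β : ℝ) :
    ContDiff ℝ 1 fun q : Vec (Fin n) × Vec (Fin m ⊕ Fin s) => psi g G α β q.1 q.2 := by
  have hy : ContDiff ℝ 1 fun q : Vec (Fin n) × Vec (Fin m ⊕ Fin s) => primalPart q.2 :=
    (primalCLM m s).contDiff.comp contDiff_snd
  have hp : ContDiff ℝ 1 fun q : Vec (Fin n) × Vec (Fin m ⊕ Fin s) => dualPart q.2 :=
    (dualCLM m s).contDiff.comp contDiff_snd
  have hxy : ContDiff ℝ 1 fun q : Vec (Fin n) × Vec (Fin m ⊕ Fin s) => (q.1, primalPart q.2) :=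
    contDiff_fst.prodMk hy
  have hg' : ContDiff ℝ 1 (fderiv ℝ g) := hg.fderiv_right (by norm_num)
  have hG' : ContDiff ℝ 1 (fderiv ℝ G) := hG.fderiv_right (by norm_num)
  have hgd := hg.differentiable two_ne_zero
  have hGd := hG.differentiable two_ne_zero
  have h1 : ContDiff ℝ 1 fun q : Vec (Fin n) × Vec (Fin m ⊕ Fin s) =>
      gradY g q.1 (primalPart q.2) := by
    rw [contDiff_euclidean]
    intro j
    have e : ∀ q : Vec (Fin n) × Vec (Fin m ⊕ Fin s), gradY g q.1 (primalPart q.2) j =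
        fderiv ℝ g (q.1, primalPart q.2) (0, EuclideanSpace.single j 1) := by
      intro q
      rw [← inner_gradY hgd, EuclideanSpace.inner_single_right]
      simp
    rw [funext e]
    exact (hg'.comp hxy).clm_apply contDiff_const
  have h2 : ContDiff ℝ 1 fun q : Vec (Fin n) × Vec (Fin m ⊕ Fin s) =>
      (WithLp.toLp 2 ((jacY G q.1 (primalPart q.2)).transpose.mulVec (dualPart q.2)) :
        Vec (Fin m)) := by
    rw [contDiff_euclidean]
    intro j
    have e : ∀ q : Vec (Fin n) × Vec (Fin m ⊕ Fin s),
        (WithLp.toLp 2 ((jacY G q.1 (primalPart q.2)).transpose.mulVec (dualPart q.2)) :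
          Vec (Fin m)) j = inner ℝ (dualPart q.2)
            (fderiv ℝ G (q.1, primalPart q.2) (0, EuclideanSpace.single j 1)) := by
      intro q
      rw [← toLp_jacY_mulVec hGd, ← inner_transpose_mulVec, EuclideanSpace.inner_single_right]
      simp
    rw [funext e]
    exact hp.inner ℝ ((hG'.comp hxy).clm_apply contDiff_const)
  have h3 : ContDiff ℝ 1 fun q : Vec (Fin n) × Vec (Fin m ⊕ Fin s) => G (q.1, primalPart q.2) :=
    (hG.of_le one_le_two).comp hxy
  exact (pairCLM m s).contDiff.comp
    (((h1.neg.sub h2).sub (hy.const_smul β)).prodMk (h3.neg.add (hp.const_smul α)))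

end LowerLevel

/-! ### The derivative of `-ψ` and nonsingularity of the KKT matrix -/

section Differentiation

variable {n m s : ℕ} {g : Vec (Fin n) × Vec (Fin m) → ℝ}
  {G : Vec (Fin n) × Vec (Fin m) → Vec (Fin s)} {h : Vec (Fin s) → EReal} {α β : ℝ}

theorem hasFDerivAt_comp_neg_psi {V Z : Type*} [NormedAddCommGroup V] [NormedSpace ℝ V]
    [NormedAddCommGroup Z] [NormedSpace ℝ Z] (hg : ContDiff ℝ 2 g) (hG : ContDiff ℝ 2 G)
    (T : Vec (Fin m ⊕ Fin s) →L[ℝ] Z) {N : V → Vec (Fin n) × Vec (Fin m ⊕ Fin s)}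
    {N' : V →L[ℝ] Vec (Fin n) × Vec (Fin m ⊕ Fin s)} {t : V} (hN : HasFDerivAt N N' t) :
    HasFDerivAt (fun t => T (-psi g G α β (N t).1 (N t).2))
      (T ∘L (fderiv ℝ (fun q : Vec (Fin n) × Vec (Fin m ⊕ Fin s) => -psi g G α β q.1 q.2) (N t)
        ∘L N')) t :=
  T.hasFDerivAt.comp t
    (((contDiff_psi hg hG α β).neg.differentiable one_ne_zero (N t)).hasFDerivAt.comp t hN)

theorem hasFDerivAt_pair_right (y : Vec (Fin m)) (p : Vec (Fin s)) (x : Vec (Fin n)) :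
    HasFDerivAt (fun y' => (x, pair y' p))
      (ContinuousLinearMap.inr ℝ (Vec (Fin n)) _ ∘L (pairCLM m s ∘L .inl ℝ _ _)) y :=
  (hasFDerivAt_prodMk_right x _).comp y
    ((pairCLM m s).hasFDerivAt.comp y (hasFDerivAt_prodMk_left y p))

theorem hasFDerivAt_pair_left (y : Vec (Fin m)) (p : Vec (Fin s)) (x : Vec (Fin n)) :
    HasFDerivAt (fun p' => (x, pair y p'))
      (ContinuousLinearMap.inr ℝ (Vec (Fin n)) _ ∘L (pairCLM m s ∘L .inr ℝ _ _)) p :=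
  (hasFDerivAt_prodMk_right x _).comp p
    ((pairCLM m s).hasFDerivAt.comp p (hasFDerivAt_prodMk_right y p))

theorem pair_add_pair (y y' : Vec (Fin m)) (p p' : Vec (Fin s)) :
    pair y p + pair y' p' = pair (y + y') (p + p') :=
  ((pairCLM m s).map_add (y, p) (y', p')).symm

theorem toLp_paramMatrix_mulVec (x : Vec (Fin n)) (y : Vec (Fin m)) (p : Vec (Fin s))
    (ξ : Vec (Fin n)) :
    WithLp.toLp 2 ((paramMatrix g G h α β x y p).mulVec ξ) =
      pair (WithLp.toLp 2 ((gradXGradYLagrangian g G h α β x y p).mulVec ξ))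
        (WithLp.toLp 2 ((jacX G x y).mulVec ξ)) := by
  ext (i | i) <;> rfl

theorem toLp_kktMatrix_mulVec (x : Vec (Fin n)) (y : Vec (Fin m)) (p : Vec (Fin s))
    (w : Vec (Fin m ⊕ Fin s)) :
    WithLp.toLp 2 ((kktMatrix g G h α β x y p).mulVec w) =
      pair (WithLp.toLp 2 ((hessYYLagrangian g G h α β x y p).mulVec (primalPart w)) +
          WithLp.toLp 2 ((jacY G x y).transpose.mulVec (dualPart w)))
        (WithLp.toLp 2 ((jacY G x y).mulVec (primalPart w)) - α • dualPart w) := by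
  rw [kktMatrix, Matrix.fromBlocks_mulVec, Matrix.neg_mulVec, Matrix.smul_mulVec,
    Matrix.one_mulVec]
  ext (i | i)
  · rfl
  · exact (sub_eq_add_neg _ _).symm

/-- The derivative of `-ψ` in terms of second derivatives of the Lagrangian. -/
theorem fderiv_neg_psi (hg : ContDiff ℝ 2 g) (hG : ContDiff ℝ 2 G) {p : Vec (Fin s)} {r : ℝ}
    (hr : conjugate h p = r) (x : Vec (Fin n)) (y : Vec (Fin m)) (ξ : Vec (Fin n))
    (w : Vec (Fin m ⊕ Fin s)) :
    fderiv ℝ (fun q : Vec (Fin n) × Vec (Fin m ⊕ Fin s) => -psi g G α β q.1 q.2) (x, pair y p)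
        (ξ, w) =
      WithLp.toLp 2 ((paramMatrix g G h α β x y p).mulVec ξ +
        (kktMatrix g G h α β x y p).mulVec w) := by
  set D := fderiv ℝ (fun q : Vec (Fin n) × Vec (Fin m ⊕ Fin s) => -psi g G α β q.1 q.2)
    (x, pair y p)
  have hgd := hg.differentiable two_ne_zero
  have hGd := hG.differentiable two_ne_zero
  have hL := gradYLagrangian_eq (α := α) (β := β) hgd hGd hr
  have px : primalPart (D (ξ, 0)) =
      WithLp.toLp 2 ((gradXGradYLagrangian g G h α β x y p).mulVec ξ) := by
    have e : (fun x' => gradYLagrangian g G h α β x' y p) =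
        fun x' => primalCLM m s (-psi g G α β x' (pair y p)) := by
      funext x'
      rw [hL, primalCLM_apply, primalPart_neg_psi]
      rfl
    rw [gradXGradYLagrangian, toLp_jacobian_mulVec, e, (hasFDerivAt_comp_neg_psi hg hG
      (primalCLM m s) (hasFDerivAt_prodMk_left x (pair y p))).fderiv]
    rfl
  have dx : dualPart (D (ξ, 0)) = WithLp.toLp 2 ((jacX G x y).mulVec ξ) := by
    have h1 := hasFDerivAt_comp_neg_psi (α := α) (β := β) hg hG
      (dualCLM m s) (hasFDerivAt_prodMk_left x (pair y p))
    have e : (fun x' => dualCLM m s (-psi g G α β x' (pair y p))) =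
        fun x' => G (x', y) - α • p := by
      funext x'
      rw [dualCLM_apply, dualPart_neg_psi]
      rfl
    have h2 := (hasFDerivAt_comp_prodMk_left hGd x y).sub_const (α • p)
    rw [← e] at h2
    rw [jacX, toLp_jacobian_mulVec, (hasFDerivAt_comp_prodMk_left hGd x y).fderiv, ← h1.unique h2]
    rfl
  have py : ∀ η, primalPart (D (0, pair η 0)) =
      WithLp.toLp 2 ((hessYYLagrangian g G h α β x y p).mulVec η) := by
    intro η
    have e : (fun y' => gradYLagrangian g G h α β x y' p) =
        fun y' => primalCLM m s (-psi g G α β x (pair y' p)) := by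
      funext y'
      rw [hL, primalCLM_apply, primalPart_neg_psi]
      rfl
    rw [hessYYLagrangian, toLp_jacobian_mulVec, e, (hasFDerivAt_comp_neg_psi hg hG
      (primalCLM m s) (hasFDerivAt_pair_right y p x)).fderiv]
    rfl
  have dy : ∀ η, dualPart (D (0, pair η 0)) = WithLp.toLp 2 ((jacY G x y).mulVec η) := by
    intro η
    have h1 := hasFDerivAt_comp_neg_psi (α := α) (β := β) hg hG
      (dualCLM m s) (hasFDerivAt_pair_right y p x)
    have e : (fun y' => dualCLM m s (-psi g G α β x (pair y' p))) =
        fun y' => G (x, y') - α • p := by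
      funext y'
      rw [dualCLM_apply, dualPart_neg_psi]
      rfl
    have h2 := (hasFDerivAt_comp_prodMk_right hGd x y).sub_const (α • p)
    rw [← e] at h2
    rw [jacY, toLp_jacobian_mulVec, (hasFDerivAt_comp_prodMk_right hGd x y).fderiv, ← h1.unique h2]
    rfl
  have pp : ∀ π, primalPart (D (0, pair 0 π)) =
      WithLp.toLp 2 ((jacY G x y).transpose.mulVec π) := by
    intro π
    have h1 := hasFDerivAt_comp_neg_psi (α := α) (β := β) hg hG
      (primalCLM m s) (hasFDerivAt_pair_left y p x)
    let M : Vec (Fin s) →L[ℝ] Vec (Fin m) :=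
      LinearMap.toContinuousLinearMap (Matrix.toEuclideanLin (jacY G x y).transpose)
    have e : (fun p' => primalCLM m s (-psi g G α β x (pair y p'))) =
        fun p' => gradY g x y + M p' + β • y := by
      funext p'
      rw [primalCLM_apply, primalPart_neg_psi]
      rfl
    have h2 : HasFDerivAt (fun p' => gradY g x y + M p' + β • y) M p :=
      (M.hasFDerivAt.const_add _).add_const _
    exact DFunLike.congr_fun (h1.unique (h2.congr_of_eventuallyEq (.of_eq e))) π
  have dp : ∀ π, dualPart (D (0, pair 0 π)) = -(α • π) := by
    intro π
    have h1 := hasFDerivAt_comp_neg_psi (α := α) (β := β) hg hG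
      (dualCLM m s) (hasFDerivAt_pair_left y p x)
    have e : (fun p' => dualCLM m s (-psi g G α β x (pair y p'))) =
        fun p' => G (x, y) - α • p' := by
      funext p'
      rw [dualCLM_apply, dualPart_neg_psi]
      rfl
    have h2 := ((hasFDerivAt_id (𝕜 := ℝ) p).const_smul α).const_sub (G (x, y))
    have h3 := DFunLike.congr_fun (h1.unique (h2.congr_of_eventuallyEq (.of_eq e))) π
    exact h3
  have hsplit : D (ξ, w) =
      D (ξ, 0) + D (0, pair (primalPart w) 0) + D (0, pair 0 (dualPart w)) := by
    rw [← map_add, ← map_add]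
    congr 1
    refine Prod.ext (by simp) ?_
    ext (i | i) <;> simp [pair, primalPart, dualPart]
  rw [hsplit, ← pair_primalPart_dualPart (D (ξ, 0)), px, dx,
    ← pair_primalPart_dualPart (D (0, pair _ 0)), py, dy,
    ← pair_primalPart_dualPart (D (0, pair 0 _)), pp, dp, WithLp.toLp_add,
    toLp_paramMatrix_mulVec, toLp_kktMatrix_mulVec, add_assoc, pair_add_pair, sub_eq_add_neg]

/-- For `p ≥ 0`, `g + ⟨G, p⟩` is convex in `y`, so adding `βy` to its gradient gives a map strongly
monotone with constant `β`. -/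
theorem inner_hessYYLagrangian_ge (hg : ContDiff ℝ 2 g) (hG : ContDiff ℝ 2 G)
    (hg_convex : ∀ x, ConvexOn ℝ univ fun y => g (x, y))
    (hG_convex : ∀ x i, ConvexOn ℝ univ fun y => G (x, y) i) {p : Vec (Fin s)} {r : ℝ}
    (hp : ∀ i, 0 ≤ p i) (hr : conjugate h p = r) (x : Vec (Fin n)) (y η : Vec (Fin m)) :
    β * ‖η‖ ^ 2 ≤
      inner ℝ (WithLp.toLp 2 ((hessYYLagrangian g G h α β x y p).mulVec η) : Vec (Fin m)) η := by
  have hgd := hg.differentiable two_ne_zero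
  have hGd := hG.differentiable two_ne_zero
  have hL := gradYLagrangian_eq (α := α) (β := β) hgd hGd hr
  rw [hessYYLagrangian, toLp_jacobian_mulVec]
  refine inner_fderiv_ge_of_strongly_monotone (fun y y' => ?_) ?_ η
  · have c1 := add_inner_gradSum_le hgd hGd hg_convex hG_convex hp x y y'
    have c2 := add_inner_gradSum_le hgd hGd hg_convex hG_convex hp x y' y
    have e1 : ‖y' - y‖ ^ 2 = inner ℝ y' (y' - y) - inner ℝ y (y' - y) := by
      rw [← inner_sub_left, real_inner_self_eq_norm_sq]
    rw [← neg_sub y' y, inner_neg_right] at c2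
    rw [hL, hL, e1]
    simp only [inner_sub_left, inner_add_left, real_inner_smul_left]
    linarith
  · have e : (fun y' => gradYLagrangian g G h α β x y' p) =
        fun y' => primalCLM m s (-psi g G α β x (pair y' p)) := by
      funext y'
      rw [hL, primalCLM_apply, primalPart_neg_psi]
      rfl
    rw [e]
    exact (hasFDerivAt_comp_neg_psi hg hG (primalCLM m s)
      (hasFDerivAt_pair_right y p x)).differentiableAt

/-- Invertibility of the KKT matrix on products `ℝ^m × K`. -/
theorem eq_zero_of_kktMatrix_mulVec_mem_orthogonal (hg : ContDiff ℝ 2 g) (hG : ContDiff ℝ 2 G)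
    (hg_convex : ∀ x, ConvexOn ℝ univ fun y => g (x, y))
    (hG_convex : ∀ x i, ConvexOn ℝ univ fun y => G (x, y) i) (hα : 0 < α) (hβ : 0 < β)
    {p : Vec (Fin s)} {r : ℝ} (hp : ∀ i, 0 ≤ p i) (hr : conjugate h p = r) (x : Vec (Fin n))
    (y : Vec (Fin m)) (K : Submodule ℝ (Vec (Fin s))) {w : Vec (Fin m ⊕ Fin s)}
    (hw : w ∈ K.comap (dualCLM m s).toLinearMap)
    (hA : WithLp.toLp 2 ((kktMatrix g G h α β x y p).mulVec w) ∈
      (K.comap (dualCLM m s).toLinearMap)ᗮ) : w = 0 := by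
  -- Flipping the sign of the dual part cancels the off-diagonal blocks and leaves `⟨∇²_{yy}L η, η⟩
  -- + α|π|² = 0` for `w = (η, π)`.
  have h0 := (Submodule.mem_orthogonal' _ _).1 hA (pair (primalPart w) (-dualPart w))
    (K.neg_mem hw)
  have hH := inner_hessYYLagrangian_ge (α := α) (β := β) hg hG hg_convex hG_convex hp hr x y
    (primalPart w)
  rw [toLp_kktMatrix_mulVec, inner_eq_primal_add_dual] at h0
  simp only [primalPart_pair, dualPart_pair, inner_add_left, inner_transpose_mulVec,
    inner_neg_right, inner_sub_left, real_inner_smul_left, real_inner_self_eq_norm_sq] at h0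
  have hJ := real_inner_comm (dualPart w)
    (WithLp.toLp 2 ((jacY G x y).mulVec (primalPart w)) : Vec (Fin s))
  have hα' := mul_nonneg hα.le (sq_nonneg ‖dualPart w‖)
  have hβ' := mul_nonneg hβ.le (sq_nonneg ‖primalPart w‖)
  have hy0 : ‖primalPart w‖ ^ 2 = 0 := by
    refine (mul_eq_zero.1 (?_ : β * ‖primalPart w‖ ^ 2 = 0)).resolve_left hβ.ne'
    linarith
  have hp0 : ‖dualPart w‖ ^ 2 = 0 := by
    refine (mul_eq_zero.1 (?_ : α * ‖dualPart w‖ ^ 2 = 0)).resolve_left hα.ne'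
    linarith
  rw [← pair_primalPart_dualPart w, norm_eq_zero.1 (pow_eq_zero_iff two_ne_zero |>.1 hy0),
    norm_eq_zero.1 (pow_eq_zero_iff two_ne_zero |>.1 hp0)]
  exact map_zero (pairCLM m s)

theorem mem_orthogonal_comap_dual {K : Submodule ℝ (Vec (Fin s))} {u : Vec (Fin m ⊕ Fin s)}
    (hu : u ∈ (K.comap (dualCLM m s).toLinearMap)ᗮ) : primalPart u = 0 ∧ dualPart u ∈ Kᗮ := by
  rw [Submodule.mem_orthogonal] at hu
  constructor
  · have := hu (pair (primalPart u) 0) K.zero_mem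
    rw [inner_eq_primal_add_dual] at this
    simpa using this
  · rw [Submodule.mem_orthogonal]
    intro q hq
    have := hu (pair 0 q) hq
    rw [inner_eq_primal_add_dual] at this
    simpa using this

end Differentiation

end Bilevel

/-! ### The main theorem -/

open Bilevel in
theorem theorem2 (n m s : ℕ)
    (g : Vec (Fin n) × Vec (Fin m) → ℝ) (G : Vec (Fin n) × Vec (Fin m) → Vec (Fin s))
    (h : Vec (Fin s) → EReal)
    (hg : ContDiff ℝ 2 g) (hG : ContDiff ℝ 2 G)
    (hg_convex : ∀ x, ConvexOn ℝ Set.univ fun y => g (x, y))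
    (hG_convex : ∀ x i, ConvexOn ℝ Set.univ fun y => G (x, y) i)
    (h_proper : IsProper h) (h_poly : IsEpiPolyhedral h) (h_mono : IsNondecreasing h)
    (α β : ℝ) (hα : 0 < α) (hβ : 0 < β)
    (xbar : Vec (Fin n)) (ybar : Vec (Fin m)) (pbar : Vec (Fin s))
    (hsol : pair ybar pbar ∈ solutionMap g G h α β xbar)
    (hri : G (xbar, ybar) - α • pbar ∈
      intrinsicInterior ℝ (subdifferential (conjugate h) pbar)) :
    ∃ (U : Set (Vec (Fin n))) (S : Vec (Fin n) → Vec (Fin m ⊕ Fin s))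
      (W : Submodule ℝ (Vec (Fin m ⊕ Fin s))),
      IsOpen U ∧ xbar ∈ U ∧
      (∀ x ∈ U, solutionMap g G h α β x = {S x}) ∧
      ContDiffOn ℝ 1 S U ∧
      (W : Set (Vec (Fin m ⊕ Fin s))) =
        criticalProduct m h pbar (G (xbar, ybar) - α • pbar) ∧
      ∀ (k : ℕ) (B : Matrix (Fin m ⊕ Fin s) (Fin k) ℝ), ColumnsFormBasis B W →
        IsUnit (B.transpose * kktMatrix g G h α β xbar ybar pbar * B) ∧
        jacobian S xbar =
          -(B * (B.transpose * kktMatrix g G h α β xbar ybar pbar * B)⁻¹ * B.transpose *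
            paramMatrix g G h α β xbar ybar pbar) := by
  set ubar := G (xbar, ybar) - α • pbar
  have hsub := intrinsicInterior_subset hri
  obtain ⟨r, hr, -⟩ := mem_subdifferential_conjugate.1 hsub
  have hp := nonneg_of_conjugate_ne_top h_proper h_mono hr
  have hgd := hg.differentiable two_ne_zero
  have hGd := hG.differentiable two_ne_zero
  set L := vectorSpan ℝ (subdifferential (conjugate h) pbar)
  obtain ⟨ε, hε, hloc⟩ := exists_forall_mem_subdifferential_conjugate h_poly h_proper hri
  let Ψ : Vec (Fin n) × Vec (Fin m ⊕ Fin s) → Vec (Fin m ⊕ Fin s) :=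
    fun q => -psi g G α β q.1 q.2
  have hΨ : ContDiff ℝ 1 Ψ := (contDiff_psi hg hG α β).neg
  set W : Submodule ℝ (Vec (Fin m ⊕ Fin s)) := Lᗮ.comap (dualCLM m s).toLinearMap
  have hD : ∀ ξ w, fderiv ℝ Ψ (xbar, pair ybar pbar) (ξ, w) =
      WithLp.toLp 2 ((paramMatrix g G h α β xbar ybar pbar).mulVec ξ +
        (kktMatrix g G h α β xbar ybar pbar).mulVec w) :=
    fderiv_neg_psi hg hG hr xbar ybar
  have hA : ∀ w ∈ W, WithLp.toLp 2 ((kktMatrix g G h α β xbar ybar pbar).mulVec w) ∈ Wᗮ → w = 0 :=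
    fun w => eq_zero_of_kktMatrix_mulVec_mem_orthogonal hg hG hg_convex hG_convex hα hβ hp hr
      xbar ybar Lᗮ
  obtain ⟨S, hSc, hS0, hSev, hSd⟩ := exists_implicit_of_projected_injective hΨ W xbar
    (pair ybar pbar) fun w hw hwo => hA w hw (by simpa [hD] using hwo)
  have hΨp : primalPart (Ψ (xbar, pair ybar pbar)) = 0 := by
    rw [← (mem_solutionMap_iff.1 hsol).1]
    exact primalPart_neg_psi _ _
  have hΨu : dualPart (Ψ (xbar, pair ybar pbar)) = ubar := dualPart_neg_psi _ _
  have hcΨ : ContinuousAt (fun x => dualPart (Ψ (x, S x))) xbar :=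
    (dualCLM m s).continuous.continuousAt.comp
      (hΨ.continuous.continuousAt.comp (continuousAt_id.prodMk hSc.continuousAt))
  have hcS : ContinuousAt (fun x => dualPart (S x)) xbar :=
    (dualCLM m s).continuous.continuousAt.comp hSc.continuousAt
  have hev : ∀ᶠ x in 𝓝 xbar, S x ∈ solutionMap g G h α β x ∧ ContDiffAt ℝ 1 S x := by
    have n1 := Metric.tendsto_nhds.1 hcΨ.tendsto ε hε
    have n2 := Metric.tendsto_nhds.1 hcS.tendsto ε hε
    -- By continuity the dual parts of `S x` and `Ψ (x, S x)` stay `ε`-close to `p̄` and `ū`, where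
    -- the graph of `∂h*` is known; being `C¹` at a point also persists nearby.
    filter_upwards [hSev, n1, n2, hSc.eventually (by simp)] with x h1 h2 h3 h4
    refine ⟨mem_solutionMap_iff.2 ?_, h4⟩
    obtain ⟨h5, h6⟩ := mem_orthogonal_comap_dual h1.2
    rw [Submodule.orthogonal_orthogonal, dualPart_sub, hΨu] at h6
    rw [primalPart_sub, hΨp, sub_zero] at h5
    rw [hS0, dist_eq_norm] at h2 h3
    rw [hΨu] at h2
    refine ⟨(primalPart_neg_psi (α := α) x (S x)).symm.trans h5, ?_⟩
    rw [← dualPart_neg_psi (g := g) (β := β)]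
    exact hloc _ _ h1.1 h6 h3 h2
  obtain ⟨U, hU, hUo, hxU⟩ := eventually_nhds_iff.1 hev
  refine ⟨U, S, W, hUo, hxU, fun x hx => ?_, fun x hx => (hU x hx).2.contDiffWithinAt, ?_, ?_⟩
  · exact (subsingleton_solutionMap hgd hGd hg_convex hG_convex h_proper h_mono hα hβ x
      ).eq_singleton_of_mem (hU x hx).1
  · have := normalCone_of_mem_intrinsicInterior (subdifferential_conjugate_convex h pbar)
      (subdifferential_conjugate_isClosed h pbar) hri
    ext v
    change dualPart v ∈ Lᗮ ↔ dualPart v ∈ normalCone _ _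
    rw [this]
    rfl
  · intro k B hB
    have hK := hB.isUnit_transpose_mul_mul hA
    refine ⟨hK, hB.eq_neg_mul_inv_mul hK (fun ξ => ?_) fun ξ => ?_⟩
    · have := toLp_jacobian_mulVec S xbar (WithLp.toLp 2 ξ)
      exact this ▸ (hSd _).1
    · have := toLp_jacobian_mulVec S xbar (WithLp.toLp 2 ξ)
      have h2 := (hSd (WithLp.toLp 2 ξ)).2
      rw [hD, ← this] at h2
      exact h2
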